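/- Let $|p\rangle,|q\rangle,|1\rangle,|2\rangle$ be an orthonormal basis of Alice's space $\mathbb{C}^4$, and let Bob's space $\mathbb{C}^3$ and Charlie's space $\mathbb{C}^3$ have orthonormal bases $|p\rangle,|q\rangle,|1\rangle$ and $|p\rangle,|q\rangle,|2\rangle$, respectively. Put $|\epsilon_\pm\rangle=\frac{1}{\sqrt2}(|p\rangle\pm|q\rangle)$ and $|\gamma^i_\pm\rangle=\frac1{\sqrt2}(|q\rangle\pm|i\rangle)$ for $i\in\{1,2\}$, and let $\mathbb{G}_3\subset\mathbb{C}^4\otimes\mathbb{C}^3\otimes\mathbb{C}^3$ be the set of the fourteen product states $$|\epsilon_\pm\rangle|1\rangle|2\rangle,\quad |1\rangle|\gamma^1_\pm\rangle|2\rangle,\quad |\gamma^1_\pm\rangle|p\rangle|2\rangle,\quad |p\rangle|\epsilon_\pm\rangle|2\rangle,\quad |2\rangle|1\rangle|\gamma^2_\pm\rangle,\quad |\gamma^2_\pm\rangle|1\rangle|p\rangle,\quad |p\rangle|1\rangle|\epsilon_\pm\rangle .$$ In the task $\tau_3$, a state drawn from $\mathbb{G}_3$ according to a known probability distribution that gives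 every element positive probability (for instance the uniform one) is distributed to Alice, Bob and Charlie, who have to identify it by local operations and classical communication (LOCC), assisted by one copy of a resource state that they share. The payoff $\mathcal{P}_{\tau_3}(\rho)$ of a resource state $\rho$ is the supremum, over all LOCC protocols with finitely many rounds, of the probability of identifying the state correctly, and $\rho\succ_{\tau_3}\sigma$ means $\mathcal{P}_{\tau_3}(\rho)>\mathcal{P}_{\tau_3}(\sigma)$. Then, for the three-qubit GHZ state $|g_3\rangle=\frac{1}{\sqrt2}(|000\rangle+|111\rangle)$ shared by the three parties, for all $d_1,d_2$ and every density operator $\rho$ on $\mathbb{C}^{d_1}\otimes\mathbb{C}^{d_2}$ shared by any two of the three parties, one has $|g_3\rangle\succ_{\tau_3}\rho$. -/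

import Mathlib

open scoped Matrix BigOperators ComplexOrder

noncomputable section

namespace LSD

/-! Finite-dimensional quantum systems: a system with finite basis `A` has Hilbert space `ℂ^A`,
and its operators are matrices indexed by `A`. -/

/-- The computational basis vector `|i⟩`. -/
def ket {A : Type} [DecidableEq A] (i : A) : A → ℂ := Pi.single i 1

/-- The sign `+` (for `true`) or `-` (for `false`). -/
def sgn (s : Bool) : ℂ := if s then 1 else -1

/-- `(|i⟩ ± |j⟩) / √2`. -/
def pm {A : Type} [DecidableEq A] (i j : A) (s : Bool) : A → ℂ :=
  ((Real.sqrt 2 : ℝ) : ℂ)⁻¹ • (ket i + sgn s • ket j)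

/-- The product vector `|a⟩ ⊗ |b⟩ ⊗ |c⟩`. -/
def prod3 {A B C : Type} (a : A → ℂ) (b : B → ℂ) (c : C → ℂ) : A × B × C → ℂ :=
  fun x => a x.1 * b x.2.1 * c x.2.2

/-- The projector `|ψ⟩⟨ψ|`. -/
def proj {A : Type} (ψ : A → ℂ) : Matrix A A ℂ := Matrix.vecMulVec ψ (star ψ)

/-- Density operators. -/
def IsDensity {A : Type} [Fintype A] (ρ : Matrix A A ℂ) : Prop :=
  ρ.PosSemidef ∧ ρ.trace = 1

/-! ### LOCC protocols -/

open Classical in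
/-- A family of Kraus operators, one for each outcome, is a quantum measurement:
`∑ₖ Kₖ† Kₖ = 1`. The output system may differ from the input system, so that appending,
discarding and transforming local ancillas, as well as drawing random numbers, are included. -/
def IsMeasurement {κ A A' : Type} [Fintype κ] [Fintype A'] (K : κ → Matrix A' A ℂ) : Prop :=
  ∑ k, (K k)ᴴ * K k = 1

/-- Three-party finite-round LOCC protocols that end by announcing an element of `Ω`; the local
systems of the parties are currently `A`, `B`, `C`. In each step one party measures its own system
and broadcasts the outcome, on which everything that follows may depend. -/
inductive LOCC (Ω : Type) : Type → Type → Type → Type 1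
  | announce {A B C : Type} (ω : Ω) : LOCC Ω A B C
  | alice {A B C : Type} (κ A' : Type) [Fintype κ] [Fintype A'] (K : κ → Matrix A' A ℂ)
      (hK : IsMeasurement K) (next : κ → LOCC Ω A' B C) : LOCC Ω A B C
  | bob {A B C : Type} (κ B' : Type) [Fintype κ] [Fintype B'] (K : κ → Matrix B' B ℂ)
      (hK : IsMeasurement K) (next : κ → LOCC Ω A B' C) : LOCC Ω A B C
  | charlie {A B C : Type} (κ C' : Type) [Fintype κ] [Fintype C'] (K : κ → Matrix C' C ℂ)
      (hK : IsMeasurement K) (next : κ → LOCC Ω A B C') : LOCC Ω A B C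

/-- `(K ⊗ 1 ⊗ 1) σ (K ⊗ 1 ⊗ 1)†`. -/
def actA {A B C A' : Type} [Fintype A] (K : Matrix A' A ℂ)
    (σ : Matrix (A × B × C) (A × B × C) ℂ) : Matrix (A' × B × C) (A' × B × C) ℂ :=
  fun x y => ∑ u, ∑ v, K x.1 u * σ (u, x.2.1, x.2.2) (v, y.2.1, y.2.2) * star (K y.1 v)

/-- `(1 ⊗ K ⊗ 1) σ (1 ⊗ K ⊗ 1)†`. -/
def actB {A B C B' : Type} [Fintype B] (K : Matrix B' B ℂ)
    (σ : Matrix (A × B × C) (A × B × C) ℂ) : Matrix (A × B' × C) (A × B' × C) ℂ :=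
  fun x y => ∑ u, ∑ v, K x.2.1 u * σ (x.1, u, x.2.2) (y.1, v, y.2.2) * star (K y.2.1 v)

/-- `(1 ⊗ 1 ⊗ K) σ (1 ⊗ 1 ⊗ K)†`. -/
def actC {A B C C' : Type} [Fintype C] (K : Matrix C' C ℂ)
    (σ : Matrix (A × B × C) (A × B × C) ℂ) : Matrix (A × B × C') (A × B × C') ℂ :=
  fun x y => ∑ u, ∑ v, K x.2.2 u * σ (x.1, x.2.1, u) (y.1, y.2.1, v) * star (K y.2.2 v)

open Classical in
/-- The probability that the protocol, run on the (possibly subnormalized) state `σ`,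
announces `ω`. -/
def LOCC.prob {Ω : Type} (ω : Ω) {A B C : Type} (P : LOCC Ω A B C)
    [Fintype A] [Fintype B] [Fintype C] (σ : Matrix (A × B × C) (A × B × C) ℂ) : ℝ :=
  match P with
  | .announce ω' => if ω' = ω then σ.trace.re else 0
  | @LOCC.alice _ _ _ _ _ _ _ _ K _ next => ∑ k, (next k).prob ω (actA (K k) σ)
  | @LOCC.bob _ _ _ _ _ _ _ _ K _ next => ∑ k, (next k).prob ω (actB (K k) σ)
  | @LOCC.charlie _ _ _ _ _ _ _ _ K _ next => ∑ k, (next k).prob ω (actC (K k) σ)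

/-! ### The discrimination task -/

/-- Labels of the fourteen states: seven pairs `±`. -/
abbrev Label : Type := Fin 7 × Bool

/-- The set `𝔾₃ ⊂ ℂ⁴ ⊗ ℂ³ ⊗ ℂ³`. Alice's basis `|p⟩, |q⟩, |1⟩, |2⟩` is `0, 1, 2, 3`;
Bob's basis `|p⟩, |q⟩, |1⟩` and Charlie's basis `|p⟩, |q⟩, |2⟩` are both `0, 1, 2`. -/
def zeta : Label → Fin 4 × Fin 3 × Fin 3 → ℂ
  | (0, s) => prod3 (pm 0 1 s) (ket 2) (ket 2)
  | (1, s) => prod3 (ket 2) (pm 1 2 s) (ket 2)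
  | (2, s) => prod3 (pm 1 2 s) (ket 0) (ket 2)
  | (3, s) => prod3 (ket 0) (pm 0 1 s) (ket 2)
  | (4, s) => prod3 (ket 3) (ket 2) (pm 1 2 s)
  | (5, s) => prod3 (pm 1 3 s) (ket 2) (ket 0)
  | (6, s) => prod3 (ket 0) (ket 2) (pm 0 1 s)

/-- The product of a state `σ` of the systems to be discriminated and a resource state `ρ`, each
party holding its part of both. -/
def withResource {A B C RA RB RC : Type} (σ : Matrix (A × B × C) (A × B × C) ℂ)
    (ρ : Matrix (RA × RB × RC) (RA × RB × RC) ℂ) :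
    Matrix ((A × RA) × (B × RB) × (C × RC)) ((A × RA) × (B × RB) × (C × RC)) ℂ :=
  fun x y =>
    σ (x.1.1, x.2.1.1, x.2.2.1) (y.1.1, y.2.1.1, y.2.2.1) *
      ρ (x.1.2, x.2.1.2, x.2.2.2) (y.1.2, y.2.1.2, y.2.2.2)

/-- Probability of identifying the state correctly, when it is `ζᵢ` with probability `p i`, the
parties share the resource `ρ` and they follow the protocol `P`. -/
def success {RA RB RC : Type} [Fintype RA] [Fintype RB] [Fintype RC] (p : Label → ℝ)
    (ρ : Matrix (RA × RB × RC) (RA × RB × RC) ℂ)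
    (P : LOCC Label (Fin 4 × RA) (Fin 3 × RB) (Fin 3 × RC)) : ℝ :=
  ∑ i, p i * P.prob i (withResource (proj (zeta i)) ρ)

/-- The payoff of the resource `ρ` in the task: the optimal (supremal) success probability over all
LOCC protocols, of any number of rounds. -/
def payoff {RA RB RC : Type} [Fintype RA] [Fintype RB] [Fintype RC] (p : Label → ℝ)
    (ρ : Matrix (RA × RB × RC) (RA × RB × RC) ℂ) : ℝ :=
  ⨆ P : LOCC Label (Fin 4 × RA) (Fin 3 × RB) (Fin 3 × RC), success p ρ P

/-- `ρ ≻ σ` in the task of discriminating `𝔾₃` with prior `p`. -/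
def StrictlyBetter {RA RB RC SA SB SC : Type} [Fintype RA] [Fintype RB] [Fintype RC]
    [Fintype SA] [Fintype SB] [Fintype SC] (p : Label → ℝ)
    (ρ : Matrix (RA × RB × RC) (RA × RB × RC) ℂ)
    (σ : Matrix (SA × SB × SC) (SA × SB × SC) ℂ) : Prop :=
  payoff p σ < payoff p ρ

/-! ### Resource states -/

/-- The GHZ vector `(|000⟩ + |111⟩) / √2`. -/
def ghz : Fin 2 × Fin 2 × Fin 2 → ℂ :=
  ((Real.sqrt 2 : ℝ) : ℂ)⁻¹ • (ket (0, 0, 0) + ket (1, 1, 1))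

/-- The two-party state `ρ` held by Alice and Bob; Charlie has a trivial resource system. -/
def sharedAB {D E : Type} (ρ : Matrix (D × E) (D × E) ℂ) :
    Matrix (D × E × Unit) (D × E × Unit) ℂ :=
  fun x y => ρ (x.1, x.2.1) (y.1, y.2.1)

/-- The two-party state `ρ` held by Bob and Charlie. -/
def sharedBC {D E : Type} (ρ : Matrix (D × E) (D × E) ℂ) :
    Matrix (Unit × D × E) (Unit × D × E) ℂ :=
  fun x y => ρ (x.2.1, x.2.2) (y.2.1, y.2.2)

/-- The two-party state `ρ` held by Alice and Charlie. -/
def sharedAC {D E : Type} (ρ : Matrix (D × E) (D × E) ℂ) :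
    Matrix (D × Unit × E) (D × Unit × E) ℂ :=
  fun x y => ρ (x.1, x.2.2) (y.1, y.2.2)

end LSD

end

open scoped Matrix BigOperators ComplexOrder

noncomputable section

namespace LSD

/-! The GHZ state yields payoff 1 (`one_le_payoff_ghz`), while every two-party resource yields
payoff bounded away from 1 uniformly over all protocols (`payoff_sharedAB_lt`, `payoff_sharedBC_lt`,
`payoff_sharedAC_lt`).

For the upper bound, merge the two parties that share the resource. Four of the seven pairs have the
register of one merged party in a fixed state and form, across the cut, the eight outer domino
states of a 3 × 3 grid. The resource vector only tensors onto the merged side, so it suffices that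
LOCC fails on domino states by a fixed amount. Along a protocol the states remain domino states
built on vectors `v i`, `w i`, with squared norms `x i`, `y i`. If one sign of a pair is suppressed,
the two norms behind it must agree; otherwise the overlap is at least of the order of `imb`. Their
weighted sum `loss` is convex and homogeneous in each argument, hence subadditive under
measurements, but it vanishes at the start. So `potential` raises it to a plateau `X * Y / 500`
(`X`, `Y` the total weights) near balanced weights. One party's measurement changes only one of `x`,
`y`, and small loss with one side balanced forces the other side to be balanced
(`balanced_of_imb_lt`). Thus a branch can leave the plateau only where the loss has already reached
its height, and the potential remains subadditive (`potential_sum_left`, `potential_sum_right`). At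
a leaf only one domino state can be answered correctly, and the others carry at least a quarter of
the potential (`potential_le`). Induction over the protocol gives a failure probability of at least
a positive multiple of the initial plateau.

For the lower bound, Alice's parity measurement copies "Alice is in |p⟩" coherently into the qubits
of Bob and Charlie. Local value measurements then find the pair without disturbing the state, and
local involutions find the sign. Only the pair on which Alice superposes |p⟩ and |q⟩ is still
entangled with the qubits; there the sign is the product of three local eigenvalues
(`identifies_three_signs`). -/

/-! ### LOCC protocols on pure states -/

/-- The squared norm of a vector. -/
def nsq {X : Type} [Fintype X] (ψ : X → ℂ) : ℝ := ∑ x, Complex.normSq (ψ x)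

/-- `(K ⊗ 1 ⊗ 1) ψ`. -/
def vecA {A B C A' : Type} [Fintype A] (K : Matrix A' A ℂ) (ψ : A × B × C → ℂ) :
    A' × B × C → ℂ := fun x => ∑ u, K x.1 u * ψ (u, x.2.1, x.2.2)

/-- `(1 ⊗ K ⊗ 1) ψ`. -/
def vecB {A B C B' : Type} [Fintype B] (K : Matrix B' B ℂ) (ψ : A × B × C → ℂ) :
    A × B' × C → ℂ := fun x => ∑ u, K x.2.1 u * ψ (x.1, u, x.2.2)

/-- `(1 ⊗ 1 ⊗ K) ψ`. -/
def vecC {A B C C' : Type} [Fintype C] (K : Matrix C' C ℂ) (ψ : A × B × C → ℂ) :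
    A × B × C' → ℂ := fun x => ∑ u, K x.2.2 u * ψ (x.1, x.2.1, u)

lemma nsq_nonneg {X : Type} [Fintype X] (ψ : X → ℂ) : 0 ≤ nsq ψ :=
  Finset.sum_nonneg fun _ _ => Complex.normSq_nonneg _

@[simp] lemma nsq_zero {X : Type} [Fintype X] : nsq (0 : X → ℂ) = 0 := by simp [nsq]

lemma trace_proj {X : Type} [Fintype X] (ψ : X → ℂ) : (proj ψ).trace.re = nsq ψ := by
  simp [proj, nsq, Matrix.trace, Matrix.vecMulVec_apply, Complex.normSq_apply]

lemma actA_proj {A B C A' : Type} [Fintype A] (K : Matrix A' A ℂ) (ψ : A × B × C → ℂ) :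
    actA K (proj ψ) = proj (vecA K ψ) := by
  ext x y
  simp only [actA, proj, vecA, Matrix.vecMulVec_apply, Pi.star_apply, star_sum, star_mul',
    Finset.sum_mul_sum]
  exact Finset.sum_congr rfl fun _ _ => Finset.sum_congr rfl fun _ _ => by ring

lemma actB_proj {A B C B' : Type} [Fintype B] (K : Matrix B' B ℂ) (ψ : A × B × C → ℂ) :
    actB K (proj ψ) = proj (vecB K ψ) := by
  ext x y
  simp only [actB, proj, vecB, Matrix.vecMulVec_apply, Pi.star_apply, star_sum, star_mul',
    Finset.sum_mul_sum]
  exact Finset.sum_congr rfl fun _ _ => Finset.sum_congr rfl fun _ _ => by ring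

lemma actC_proj {A B C C' : Type} [Fintype C] (K : Matrix C' C ℂ) (ψ : A × B × C → ℂ) :
    actC K (proj ψ) = proj (vecC K ψ) := by
  ext x y
  simp only [actC, proj, vecC, Matrix.vecMulVec_apply, Pi.star_apply, star_sum, star_mul',
    Finset.sum_mul_sum]
  exact Finset.sum_congr rfl fun _ _ => Finset.sum_congr rfl fun _ _ => by ring

/-- A measurement preserves the total squared norm. -/
lemma IsMeasurement.sum_nsq {κ A A' : Type} [Fintype κ] [Fintype A] [Fintype A']
    {K : κ → Matrix A' A ℂ} (hK : IsMeasurement K) (α : A → ℂ) :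
    ∑ k, nsq (fun x => ∑ u, K k x u * α u) = nsq α := by
  classical
  have key : ∀ {X : Type} [Fintype X] (φ : X → ℂ), ((nsq φ : ℝ) : ℂ) = star φ ⬝ᵥ φ := by
    intro X _ φ
    simp [nsq, dotProduct, Complex.normSq_eq_conj_mul_self]
  have e : ∀ k, (fun x => ∑ u, K k x u * α u) = K k *ᵥ α := fun k => rfl
  apply Complex.ofReal_injective
  rw [Complex.ofReal_sum]
  simp only [key, e]
  have h2 : ∀ k, star (K k *ᵥ α) ⬝ᵥ (K k *ᵥ α) = star α ⬝ᵥ (((K k)ᴴ * K k) *ᵥ α) := by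
    intro k
    rw [Matrix.star_mulVec, ← Matrix.dotProduct_mulVec, Matrix.mulVec_mulVec]
  simp only [h2]
  rw [← dotProduct_sum, ← Matrix.sum_mulVec]
  have hK' : ∑ k, (K k)ᴴ * K k = 1 := by
    rw [hK]
  rw [hK', Matrix.one_mulVec]

lemma IsMeasurement.sum_nsq_vecA {κ A B C A' : Type} [Fintype κ] [Fintype A] [Fintype B]
    [Fintype C] [Fintype A'] {K : κ → Matrix A' A ℂ} (hK : IsMeasurement K)
    (ψ : A × B × C → ℂ) : ∑ k, nsq (vecA (K k) ψ) = nsq ψ := by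
  unfold nsq
  rw [Fintype.sum_prod_type_right]
  simp_rw [Fintype.sum_prod_type_right (α₁ := A')]
  rw [Finset.sum_comm]
  exact Finset.sum_congr rfl fun y _ => hK.sum_nsq fun u => ψ (u, y)

lemma IsMeasurement.sum_nsq_vecB {κ A B C B' : Type} [Fintype κ] [Fintype A] [Fintype B]
    [Fintype C] [Fintype B'] {K : κ → Matrix B' B ℂ} (hK : IsMeasurement K)
    (ψ : A × B × C → ℂ) : ∑ k, nsq (vecB (K k) ψ) = nsq ψ := by
  simp only [nsq, Fintype.sum_prod_type]
  rw [Finset.sum_comm]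
  refine Finset.sum_congr rfl fun a _ => ?_
  have h : ∀ f : κ → B' → C → ℝ, ∑ k, ∑ b, ∑ c, f k b c = ∑ c, ∑ k, ∑ b, f k b c := by
    intro f
    rw [Finset.sum_comm (s := (Finset.univ : Finset C))]
    exact Finset.sum_congr rfl fun k _ => Finset.sum_comm
  rw [h, Finset.sum_comm (s := (Finset.univ : Finset B))]
  exact Finset.sum_congr rfl fun c _ => hK.sum_nsq fun u => ψ (a, u, c)

lemma IsMeasurement.sum_nsq_vecC {κ A B C C' : Type} [Fintype κ] [Fintype A] [Fintype B]
    [Fintype C] [Fintype C'] {K : κ → Matrix C' C ℂ} (hK : IsMeasurement K)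
    (ψ : A × B × C → ℂ) : ∑ k, nsq (vecC (K k) ψ) = nsq ψ := by
  simp only [nsq, Fintype.sum_prod_type]
  rw [Finset.sum_comm]
  refine Finset.sum_congr rfl fun a _ => ?_
  rw [Finset.sum_comm]
  exact Finset.sum_congr rfl fun b _ => hK.sum_nsq fun u => ψ (a, b, u)

/-- The probability that a protocol announces `i` on the pure state `ψ`. -/
def LOCC.vprob {Ω A B C : Type} [Fintype A] [Fintype B] [Fintype C] (P : LOCC Ω A B C) (i : Ω)
    (ψ : A × B × C → ℂ) : ℝ := P.prob i (proj ψ)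

open Classical in
lemma vprob_announce {Ω A B C : Type} [Fintype A] [Fintype B] [Fintype C] (ω i : Ω)
    (ψ : A × B × C → ℂ) :
    (LOCC.announce ω : LOCC Ω A B C).vprob i ψ = if ω = i then nsq ψ else 0 := by
  simp [LOCC.vprob, LOCC.prob, trace_proj]

lemma vprob_alice {Ω A B C κ A' : Type} [Fintype A] [Fintype B] [Fintype C] [Fintype κ]
    [Fintype A'] (K : κ → Matrix A' A ℂ) (hK : IsMeasurement K) (next : κ → LOCC Ω A' B C)
    (i : Ω) (ψ : A × B × C → ℂ) :
    (LOCC.alice κ A' K hK next).vprob i ψ = ∑ k, (next k).vprob i (vecA (K k) ψ) := by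
  simp [LOCC.vprob, LOCC.prob, actA_proj]

lemma vprob_bob {Ω A B C κ B' : Type} [Fintype A] [Fintype B] [Fintype C] [Fintype κ]
    [Fintype B'] (K : κ → Matrix B' B ℂ) (hK : IsMeasurement K) (next : κ → LOCC Ω A B' C)
    (i : Ω) (ψ : A × B × C → ℂ) :
    (LOCC.bob κ B' K hK next).vprob i ψ = ∑ k, (next k).vprob i (vecB (K k) ψ) := by
  simp [LOCC.vprob, LOCC.prob, actB_proj]

lemma vprob_charlie {Ω A B C κ C' : Type} [Fintype A] [Fintype B] [Fintype C] [Fintype κ]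
    [Fintype C'] (K : κ → Matrix C' C ℂ) (hK : IsMeasurement K) (next : κ → LOCC Ω A B C')
    (i : Ω) (ψ : A × B × C → ℂ) :
    (LOCC.charlie κ C' K hK next).vprob i ψ = ∑ k, (next k).vprob i (vecC (K k) ψ) := by
  simp [LOCC.vprob, LOCC.prob, actC_proj]

/-- The local systems change along a protocol, so the `Fintype` instances are bound after `P` for
the induction to apply to every continuation. -/
lemma vprob_nonneg {Ω : Type} (i : Ω) {A B C : Type} (P : LOCC Ω A B C) :
    ∀ [Fintype A] [Fintype B] [Fintype C] (ψ : A × B × C → ℂ), 0 ≤ P.vprob i ψ := by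
  induction P with
  | announce ω =>
    intro _ _ _ ψ
    rw [vprob_announce]; split_ifs
    exacts [nsq_nonneg _, le_rfl]
  | alice κ A' K hK next ih =>
    intro _ _ _ ψ
    rw [vprob_alice]; exact Finset.sum_nonneg fun k _ => ih k _
  | bob κ A' K hK next ih =>
    intro _ _ _ ψ
    rw [vprob_bob]; exact Finset.sum_nonneg fun k _ => ih k _
  | charlie κ A' K hK next ih =>
    intro _ _ _ ψ
    rw [vprob_charlie]; exact Finset.sum_nonneg fun k _ => ih k _

lemma vprob_le {Ω : Type} (i : Ω) {A B C : Type} (P : LOCC Ω A B C) :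
    ∀ [Fintype A] [Fintype B] [Fintype C] (ψ : A × B × C → ℂ), P.vprob i ψ ≤ nsq ψ := by
  induction P with
  | announce ω =>
    intro _ _ _ ψ
    rw [vprob_announce]; split_ifs
    exacts [le_rfl, nsq_nonneg _]
  | alice κ A' K hK next ih =>
    intro _ _ _ ψ
    rw [vprob_alice, ← hK.sum_nsq_vecA]; exact Finset.sum_le_sum fun k _ => ih k _
  | bob κ A' K hK next ih =>
    intro _ _ _ ψ
    rw [vprob_bob, ← hK.sum_nsq_vecB]; exact Finset.sum_le_sum fun k _ => ih k _
  | charlie κ A' K hK next ih =>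
    intro _ _ _ ψ
    rw [vprob_charlie, ← hK.sum_nsq_vecC]; exact Finset.sum_le_sum fun k _ => ih k _

lemma actA_sum {ι A B C A' : Type} [Fintype ι] [Fintype A] (K : Matrix A' A ℂ)
    (σ : ι → Matrix (A × B × C) (A × B × C) ℂ) :
    actA K (∑ l, σ l) = ∑ l, actA K (σ l) := by
  ext x y
  simp only [actA, Matrix.sum_apply, Finset.mul_sum, Finset.sum_mul]
  rw [Finset.sum_comm (s := (Finset.univ : Finset ι))]
  exact Finset.sum_congr rfl fun _ _ => Finset.sum_comm

lemma actB_sum {ι A B C B' : Type} [Fintype ι] [Fintype B] (K : Matrix B' B ℂ)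
    (σ : ι → Matrix (A × B × C) (A × B × C) ℂ) :
    actB K (∑ l, σ l) = ∑ l, actB K (σ l) := by
  ext x y
  simp only [actB, Matrix.sum_apply, Finset.mul_sum, Finset.sum_mul]
  rw [Finset.sum_comm (s := (Finset.univ : Finset ι))]
  exact Finset.sum_congr rfl fun _ _ => Finset.sum_comm

lemma actC_sum {ι A B C C' : Type} [Fintype ι] [Fintype C] (K : Matrix C' C ℂ)
    (σ : ι → Matrix (A × B × C) (A × B × C) ℂ) :
    actC K (∑ l, σ l) = ∑ l, actC K (σ l) := by
  ext x y
  simp only [actC, Matrix.sum_apply, Finset.mul_sum, Finset.sum_mul]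
  rw [Finset.sum_comm (s := (Finset.univ : Finset ι))]
  exact Finset.sum_congr rfl fun _ _ => Finset.sum_comm

/-- Lets a mixed resource be replaced by its pure components. -/
lemma prob_sum {Ω ι : Type} [Fintype ι] (i : Ω) {A B C : Type} (P : LOCC Ω A B C) :
    ∀ [Fintype A] [Fintype B] [Fintype C] (σ : ι → Matrix (A × B × C) (A × B × C) ℂ),
    P.prob i (∑ l, σ l) = ∑ l, P.prob i (σ l) := by
  induction P with
  | announce ω =>
    intro _ _ _ σ
    simp only [LOCC.prob]; split_ifs <;> simp [Matrix.trace_sum]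
  | alice κ A' K hK next ih =>
    intro _ _ _ σ
    simp only [LOCC.prob, actA_sum, ih]; rw [Finset.sum_comm]
  | bob κ A' K hK next ih =>
    intro _ _ _ σ
    simp only [LOCC.prob, actB_sum, ih]; rw [Finset.sum_comm]
  | charlie κ A' K hK next ih =>
    intro _ _ _ σ
    simp only [LOCC.prob, actC_sum, ih]; rw [Finset.sum_comm]

/-! ### The potential and its subadditivity -/

/-- The relative imbalance of two nonnegative weights. -/
def imb (u v : ℝ) : ℝ := (u - v) ^ 2 / (u + v)

lemma imb_nonneg {u v : ℝ} (hu : 0 ≤ u) (hv : 0 ≤ v) : 0 ≤ imb u v := by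
  unfold imb; positivity

/-- Also valid at `u = v = 0`, where the quotient in `imb` is `0` by convention. -/
lemma imb_mul {u v : ℝ} (hu : 0 ≤ u) (hv : 0 ≤ v) : imb u v * (u + v) = (u - v) ^ 2 := by
  unfold imb
  by_cases h : u + v = 0
  · have h1 : u = 0 := by linarith
    have h2 : v = 0 := by linarith
    simp [h1, h2]
  · field_simp

/-- Cauchy–Schwarz for sums of quotients `r ^ 2 / g`, applied to the differences and sums of the
weights. -/
lemma imb_sum_le {κ : Type} [Fintype κ] {u v : κ → ℝ} (hu : ∀ k, 0 ≤ u k) (hv : ∀ k, 0 ≤ v k) :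
    imb (∑ k, u k) (∑ k, v k) ≤ ∑ k, imb (u k) (v k) := by
  have h := Finset.sum_sq_le_sum_mul_sum_of_sq_le_mul (Finset.univ : Finset κ)
    (r := fun k => u k - v k) (f := fun k => imb (u k) (v k)) (g := fun k => u k + v k)
    (fun k _ => imb_nonneg (hu k) (hv k)) (fun k _ => add_nonneg (hu k) (hv k))
    (fun k _ => (imb_mul (hu k) (hv k)).ge)
  rw [Finset.sum_sub_distrib, Finset.sum_add_distrib] at h
  unfold imb at h ⊢
  exact div_le_of_le_mul₀ (add_nonneg (Finset.sum_nonneg fun k _ => hu k)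
    (Finset.sum_nonneg fun k _ => hv k))
    (Finset.sum_nonneg fun k _ => imb_nonneg (hu k) (hv k)) h

/-- The loss of orthogonality within the four pairs of domino states, when the squared norms of the
basis vectors of the two parties have become `x` and `y`. -/
def loss (x y : Fin 3 → ℝ) : ℝ :=
  y 2 * imb (x 0) (x 1) + x 2 * imb (y 1) (y 2) + y 0 * imb (x 1) (x 2) + x 0 * imb (y 0) (y 1)

/-- No weight is much smaller than the others. -/
def Balanced (x : Fin 3 → ℝ) : Prop := ∀ i, ∑ j, x j ≤ 5 * x i

open Classical in
/-- A lower bound, up to a factor, for the failure probability of a protocol. It is constant near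
the balanced weights, and the loss of orthogonality elsewhere. -/
def potential (x y : Fin 3 → ℝ) : ℝ :=
  if Balanced x ∧ Balanced y ∧ loss x y < (∑ j, x j) * (∑ j, y j) / 500 then
    (∑ j, x j) * (∑ j, y j) / 500 else loss x y

/-- The two imbalances join the three weights in a path 0–1–2, so if both are small, all weights are
close. The coefficients `α`, `β` stand for weights of the other, balanced party and cannot hide an
imbalance. -/
lemma balanced_of_imb_lt {x : Fin 3 → ℝ} (hx : ∀ i, 0 ≤ x i) {α β Y : ℝ} (hY : 0 ≤ Y)
    (hα : Y ≤ 5 * α) (hβ : Y ≤ 5 * β)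
    (h : α * imb (x 0) (x 1) + β * imb (x 1) (x 2) < (∑ j, x j) * Y / 500) : Balanced x := by
  have h01 := imb_nonneg (hx 0) (hx 1)
  have h12 := imb_nonneg (hx 1) (hx 2)
  have e01 := imb_mul (hx 0) (hx 1)
  have e12 := imb_mul (hx 1) (hx 2)
  have h0 := hx 0
  have h1 := hx 1
  have h2 := hx 2
  rw [Fin.sum_univ_three] at h
  have hα0 : 0 ≤ α := by linarith
  have hβ0 : 0 ≤ β := by linarith
  have hp1 := mul_nonneg hα0 h01
  have hp2 := mul_nonneg hβ0 h12
  -- For `Y = 0` the hypothesis `h` would bound a nonnegative number strictly by zero.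
  have hYpos : 0 < Y := by
    rcases hY.lt_or_eq with h' | h'
    · exact h'
    · rw [← h'] at h; linarith
  set X := x 0 + x 1 + x 2 with hX
  have b1 : imb (x 0) (x 1) ≤ X / 100 := by
    have : Y * imb (x 0) (x 1) ≤ Y * (X / 100) := by
      have := mul_le_mul_of_nonneg_right hα h01
      nlinarith
    exact le_of_mul_le_mul_left this hYpos
  have b2 : imb (x 1) (x 2) ≤ X / 100 := by
    have : Y * imb (x 1) (x 2) ≤ Y * (X / 100) := by
      have := mul_le_mul_of_nonneg_right hβ h12
      nlinarith
    exact le_of_mul_le_mul_left this hYpos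
  have hX0 : 0 ≤ X := by positivity
  -- The squared difference is the imbalance times a partial sum, at most `X / 100 * X`. Two such
  -- differences leave every weight at least `7 / 30 * X`, above the required `X / 5`.
  have c1 : |x 0 - x 1| ≤ X / 10 := by
    refine abs_le_of_sq_le_sq ?_ (by positivity)
    rw [← e01]
    have : imb (x 0) (x 1) * (x 0 + x 1) ≤ X / 100 * X :=
      mul_le_mul b1 (by linarith) (by linarith) (by positivity)
    nlinarith
  have c2 : |x 1 - x 2| ≤ X / 10 := by
    refine abs_le_of_sq_le_sq ?_ (by positivity)
    rw [← e12]
    have : imb (x 1) (x 2) * (x 1 + x 2) ≤ X / 100 * X :=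
      mul_le_mul b2 (by linarith) (by linarith) (by positivity)
    nlinarith
  rw [abs_le] at c1 c2
  intro i
  rw [Fin.sum_univ_three]
  fin_cases i <;> simp <;> linarith

lemma loss_le_potential (x y : Fin 3 → ℝ) : loss x y ≤ potential x y := by
  unfold potential; split_ifs with h
  · exact h.2.2.le
  · exact le_rfl

/-- Nothing is assumed about the balance of `x`: either the loss already reaches the plateau, or its
smallness makes `x` balanced too. -/
lemma le_potential_left {x y : Fin 3 → ℝ} (hx : ∀ i, 0 ≤ x i) (hy : ∀ i, 0 ≤ y i)
    (hb : Balanced y) : (∑ j, x j) * (∑ j, y j) / 500 ≤ potential x y := by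
  by_cases h : loss x y < (∑ j, x j) * (∑ j, y j) / 500
  · have hbx : Balanced x := by
      refine balanced_of_imb_lt hx (Finset.sum_nonneg fun j _ => hy j) (hb 2) (hb 0)
        (lt_of_le_of_lt ?_ h)
      have h1 := mul_nonneg (hx 2) (imb_nonneg (hy 1) (hy 2))
      have h2 := mul_nonneg (hx 0) (imb_nonneg (hy 0) (hy 1))
      unfold loss; linarith
    rw [potential, if_pos ⟨hbx, hb, h⟩]
  · exact (not_lt.mp h).trans (loss_le_potential x y)

lemma le_potential_right {x y : Fin 3 → ℝ} (hx : ∀ i, 0 ≤ x i) (hy : ∀ i, 0 ≤ y i)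
    (hb : Balanced x) : (∑ j, x j) * (∑ j, y j) / 500 ≤ potential x y := by
  by_cases h : loss x y < (∑ j, x j) * (∑ j, y j) / 500
  · have hby : Balanced y := by
      refine balanced_of_imb_lt hy (Finset.sum_nonneg fun j _ => hx j) (hb 0) (hb 2)
        (lt_of_le_of_lt ?_ (by rwa [mul_comm (∑ j, y j)]))
      have h1 := mul_nonneg (hy 2) (imb_nonneg (hx 0) (hx 1))
      have h2 := mul_nonneg (hy 0) (imb_nonneg (hx 1) (hx 2))
      unfold loss; linarith
    rw [potential, if_pos ⟨hb, hby, h⟩]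
  · exact (not_lt.mp h).trans (loss_le_potential x y)

lemma loss_sum_left {κ : Type} [Fintype κ] {x : κ → Fin 3 → ℝ} {y : Fin 3 → ℝ}
    (hx : ∀ k i, 0 ≤ x k i) (hy : ∀ i, 0 ≤ y i) :
    loss (fun i => ∑ k, x k i) y ≤ ∑ k, loss (x k) y := by
  simp only [loss, Finset.sum_add_distrib, ← Finset.mul_sum, ← Finset.sum_mul]
  gcongr
  · exact hy 2
  · exact imb_sum_le (fun k => hx k 0) (fun k => hx k 1)
  · exact hy 0
  · exact imb_sum_le (fun k => hx k 1) (fun k => hx k 2)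

lemma loss_sum_right {κ : Type} [Fintype κ] {x : Fin 3 → ℝ} {y : κ → Fin 3 → ℝ}
    (hx : ∀ i, 0 ≤ x i) (hy : ∀ k i, 0 ≤ y k i) :
    loss x (fun i => ∑ k, y k i) ≤ ∑ k, loss x (y k) := by
  simp only [loss, Finset.sum_add_distrib, ← Finset.mul_sum, ← Finset.sum_mul]
  gcongr
  · exact hx 2
  · exact imb_sum_le (fun k => hy k 1) (fun k => hy k 2)
  · exact hx 0
  · exact imb_sum_le (fun k => hy k 0) (fun k => hy k 1)

/-- On the plateau `y` is balanced and does not change, so every branch keeps at least its share of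
a quantity linear in `x`. Off the plateau the potential is the subadditive loss. -/
lemma potential_sum_left {κ : Type} [Fintype κ] {x : κ → Fin 3 → ℝ} {y : Fin 3 → ℝ}
    (hx : ∀ k i, 0 ≤ x k i) (hy : ∀ i, 0 ≤ y i) :
    potential (fun i => ∑ k, x k i) y ≤ ∑ k, potential (x k) y := by
  rw [potential]
  split_ifs with h
  · rw [Finset.sum_comm, Finset.sum_mul, Finset.sum_div]
    exact Finset.sum_le_sum fun k _ => le_potential_left (hx k) hy h.2.1
  · exact (loss_sum_left hx hy).trans (Finset.sum_le_sum fun k _ => loss_le_potential _ _)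

lemma potential_sum_right {κ : Type} [Fintype κ] {x : Fin 3 → ℝ} {y : κ → Fin 3 → ℝ}
    (hx : ∀ i, 0 ≤ x i) (hy : ∀ k i, 0 ≤ y k i) :
    potential x (fun i => ∑ k, y k i) ≤ ∑ k, potential x (y k) := by
  rw [potential]
  split_ifs with h
  · rw [Finset.sum_comm, Finset.mul_sum, Finset.sum_div]
    exact Finset.sum_le_sum fun k _ => le_potential_right hx (hy k) h.1
  · exact (loss_sum_right hx hy).trans (Finset.sum_le_sum fun k _ => loss_le_potential _ _)

/-! ### Domino states on arbitrary vectors -/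

/-- `(u ± v) / √2`. -/
def mix {S : Type} (s : Bool) (u v : S → ℂ) : S → ℂ :=
  ((Real.sqrt 2 : ℝ) : ℂ)⁻¹ • (u + sgn s • v)

/-- The first party's factors of the eight domino states, for basis vectors `v`. -/
def domL {S : Type} (v : Fin 3 → S → ℂ) : Fin 4 × Bool → S → ℂ
  | (0, s) => mix s (v 0) (v 1)
  | (1, _) => v 2
  | (2, s) => mix s (v 1) (v 2)
  | (3, _) => v 0

/-- The second party's factors of the eight domino states, for basis vectors `w`. -/
def domR {S : Type} (w : Fin 3 → S → ℂ) : Fin 4 × Bool → S → ℂ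
  | (0, _) => w 2
  | (1, s) => mix s (w 1) (w 2)
  | (2, _) => w 0
  | (3, s) => mix s (w 0) (w 1)

lemma sgn_mul_self (s : Bool) : sgn s * sgn s = 1 := by cases s <;> simp [sgn]

lemma normSq_inv_sqrt_two : Complex.normSq (((Real.sqrt 2 : ℝ) : ℂ)⁻¹) = 1 / 2 := by
  rw [Complex.normSq_inv, Complex.normSq_ofReal, Real.mul_self_sqrt (by norm_num)]; norm_num

/-- The parallelogram law. -/
lemma nsq_mix_add {S : Type} [Fintype S] (u v : S → ℂ) :
    nsq (mix true u v) + nsq (mix false u v) = nsq u + nsq v := by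
  simp only [nsq, mix, ← Finset.sum_add_distrib, Pi.smul_apply, Pi.add_apply, smul_eq_mul,
    Complex.normSq_mul, normSq_inv_sqrt_two]
  refine Finset.sum_congr rfl fun x _ => ?_
  simp [sgn, Complex.normSq_apply]
  ring

/-- Factor the difference of squares: `|‖a‖ - ‖b‖|` is at most `‖a ± b‖` by the reverse triangle
inequality, and `(‖a‖ + ‖b‖) ^ 2` is at most twice the denominator. -/
lemma imb_normSq_le (s : Bool) (a b : ℂ) :
    imb (Complex.normSq a) (Complex.normSq b) ≤ 2 * Complex.normSq (a + sgn s * b) := by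
  have ha := Complex.normSq_nonneg a
  have hb := Complex.normSq_nonneg b
  unfold imb
  refine div_le_of_le_mul₀ (by positivity)
    (mul_nonneg zero_le_two (Complex.normSq_nonneg _)) ?_
  have h1 : |‖a‖ - ‖b‖| ≤ ‖a + sgn s * b‖ := by
    cases s
    · simpa [sgn, sub_eq_add_neg] using abs_norm_sub_norm_le a b
    · simpa [sgn] using abs_norm_sub_norm_le a (-b)
  have h2 : (‖a‖ - ‖b‖) ^ 2 ≤ ‖a + sgn s * b‖ ^ 2 := by
    rw [← sq_abs]; gcongr
  simp only [Complex.normSq_eq_norm_sq]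
  calc (‖a‖ ^ 2 - ‖b‖ ^ 2) ^ 2 = (‖a‖ - ‖b‖) ^ 2 * (‖a‖ + ‖b‖) ^ 2 := by ring
    _ ≤ ‖a + sgn s * b‖ ^ 2 * (2 * (‖a‖ ^ 2 + ‖b‖ ^ 2)) := by
      gcongr
      nlinarith [sq_nonneg (‖a‖ - ‖b‖)]
    _ = _ := by ring

lemma imb_nsq_le {S : Type} [Fintype S] (s : Bool) (u v : S → ℂ) :
    imb (nsq u) (nsq v) ≤ 4 * nsq (mix s u v) := by
  refine (imb_sum_le (fun _ => Complex.normSq_nonneg _) fun _ => Complex.normSq_nonneg _).trans ?_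
  simp only [nsq, Finset.mul_sum]
  refine Finset.sum_le_sum fun x _ => (imb_normSq_le s _ _).trans_eq ?_
  simp only [mix, Pi.smul_apply, Pi.add_apply, smul_eq_mul, Complex.normSq_mul,
    normSq_inv_sqrt_two]
  ring

/-- The potential is dominated by the total weight of all domino states but one. -/
lemma potential_le {S S' : Type} [Fintype S] [Fintype S'] (v : Fin 3 → S → ℂ)
    (w : Fin 3 → S' → ℂ) (t₀ : Fin 4 × Bool) :
    potential (fun i => nsq (v i)) (fun i => nsq (w i)) ≤
      4 * ∑ t ∈ Finset.univ.erase t₀, nsq (domL v t) * nsq (domR w t) := by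
  set E : Fin 4 × Bool → ℝ := fun t => nsq (domL v t) * nsq (domR w t) with hE
  have hE0 : ∀ t, 0 ≤ E t := fun t => mul_nonneg (nsq_nonneg _) (nsq_nonneg _)
  have hx : ∀ i, 0 ≤ nsq (v i) := fun i => nsq_nonneg _
  have hy : ∀ i, 0 ≤ nsq (w i) := fun i => nsq_nonneg _
  rw [potential]
  split_ifs with h
  · obtain ⟨hbx, hby, -⟩ := h
    -- On the plateau one intact pair suffices: with both signs present the cross terms cancel, and
    -- balance bounds the weight of the pair below.
    obtain ⟨j, hj⟩ : ∃ j : Fin 4, j ≠ t₀.1 := exists_ne _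
    have hsub : ({(j, true), (j, false)} : Finset (Fin 4 × Bool)) ⊆ Finset.univ.erase t₀ := by
      intro t ht
      simp only [Finset.mem_insert, Finset.mem_singleton] at ht
      rw [Finset.mem_erase]
      refine ⟨?_, Finset.mem_univ _⟩
      rintro rfl
      rcases ht with h | h <;> simp [h] at hj
    have h1 := Finset.sum_le_sum_of_subset_of_nonneg hsub fun t _ _ => hE0 t
    rw [Finset.sum_pair (by simp)] at h1
    refine le_trans ?_ (mul_le_mul_of_nonneg_left h1 (by norm_num))
    set X := ∑ j, nsq (v j)
    set Y := ∑ j, nsq (w j)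
    have hX : 0 ≤ X := Finset.sum_nonneg fun j _ => hx j
    have hY : 0 ≤ Y := Finset.sum_nonneg fun j _ => hy j
    have key : ∀ a b c : ℝ, X ≤ 5 * a → X ≤ 5 * b → Y ≤ 5 * c → X * Y / 500 ≤ 4 * ((a + b) * c) := by
      intro a b c ha hb hc
      have := mul_le_mul (show X / 5 ≤ a + b by linarith) (show Y / 5 ≤ c by linarith)
        (by positivity) (by linarith)
      nlinarith [mul_nonneg hX hY]
    have key' : ∀ a b c : ℝ, Y ≤ 5 * a → Y ≤ 5 * b → X ≤ 5 * c →
        X * Y / 500 ≤ 4 * (c * (a + b)) := by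
      intro a b c ha hb hc
      have := mul_le_mul (show Y / 5 ≤ a + b by linarith) (show X / 5 ≤ c by linarith)
        (by positivity) (by linarith)
      nlinarith [mul_nonneg hX hY]
    fin_cases j <;> simp only [hE, domL, domR, ← add_mul, ← mul_add, nsq_mix_add]
    · exact key _ _ _ (hbx 0) (hbx 1) (hby 2)
    · exact key' _ _ _ (hby 1) (hby 2) (hbx 2)
    · exact key _ _ _ (hbx 1) (hbx 2) (hby 0)
    · exact key' _ _ _ (hby 0) (hby 1) (hbx 0)
  -- Off the plateau, take from each pair the sign that `t₀` does not have; these four states match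
  -- the four terms of the loss.
  · have hsub : Finset.univ.image (fun j : Fin 4 => (j, !t₀.2)) ⊆ Finset.univ.erase t₀ := by
      intro t ht
      simp only [Finset.mem_image, Finset.mem_univ, true_and] at ht
      obtain ⟨j, rfl⟩ := ht
      rw [Finset.mem_erase]
      refine ⟨fun h => ?_, Finset.mem_univ _⟩
      have := congrArg Prod.snd h
      simp at this
    have h1 := Finset.sum_le_sum_of_subset_of_nonneg hsub fun t _ _ => hE0 t
    rw [Finset.sum_image (fun a _ b _ h => congrArg Prod.fst h), Fin.sum_univ_four] at h1
    refine le_trans ?_ (mul_le_mul_of_nonneg_left h1 (by norm_num))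
    simp only [hE, domL, domR, loss]
    have a0 := mul_le_mul_of_nonneg_left (imb_nsq_le (!t₀.2) (v 0) (v 1)) (hy 2)
    have a1 := mul_le_mul_of_nonneg_left (imb_nsq_le (!t₀.2) (w 1) (w 2)) (hx 2)
    have a2 := mul_le_mul_of_nonneg_left (imb_nsq_le (!t₀.2) (v 1) (v 2)) (hy 0)
    have a3 := mul_le_mul_of_nonneg_left (imb_nsq_le (!t₀.2) (w 0) (w 1)) (hx 0)
    linarith

/-! ### Failure bound across a bipartite cut -/

/-- `T t α β` being the probability of a correct answer on the domino state with index `t` and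
factors `α`, `β`, the weighted failure probability is at least `c` times the potential. -/
def FailsAtLeast {S S' : Type} [Fintype S] [Fintype S'] (c : ℝ) (q : Fin 4 × Bool → ℝ)
    (T : Fin 4 × Bool → (S → ℂ) → (S' → ℂ) → ℝ) : Prop :=
  ∀ (v : Fin 3 → S → ℂ) (w : Fin 3 → S' → ℂ),
    c * potential (fun i => nsq (v i)) (fun i => nsq (w i)) ≤
      ∑ t, q t * (nsq (domL v t) * nsq (domR w t) - T t (domL v t) (domR w t))

lemma map_mix {S S₁ : Type} (L : (S → ℂ) →ₗ[ℂ] (S₁ → ℂ)) (s : Bool) (u v : S → ℂ) :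
    mix s (L u) (L v) = L (mix s u v) := by simp [mix]

lemma domL_map {S S₁ : Type} (L : (S → ℂ) →ₗ[ℂ] (S₁ → ℂ)) (v : Fin 3 → S → ℂ)
    (t : Fin 4 × Bool) : domL (fun i => L (v i)) t = L (domL v t) := by
  obtain ⟨j, s⟩ := t
  fin_cases j <;> simp [domL, map_mix]

lemma domR_map {S S₁ : Type} (L : (S → ℂ) →ₗ[ℂ] (S₁ → ℂ)) (v : Fin 3 → S → ℂ)
    (t : Fin 4 × Bool) : domR (fun i => L (v i)) t = L (domR v t) := by
  obtain ⟨j, s⟩ := t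
  fin_cases j <;> simp [domR, map_mix]

/-- Each branch maps domino states to domino states on the vectors `L k (v i)`. Summed over branches
the weights are conserved and the potential does not decrease. -/
lemma FailsAtLeast.left {κ S S' S₁ : Type} [Fintype κ] [Fintype S] [Fintype S'] [Fintype S₁]
    {c : ℝ} (hc : 0 ≤ c) {q : Fin 4 × Bool → ℝ} {T : Fin 4 × Bool → (S → ℂ) → (S' → ℂ) → ℝ}
    {T' : κ → Fin 4 × Bool → (S₁ → ℂ) → (S' → ℂ) → ℝ} (h : ∀ k, FailsAtLeast c q (T' k))
    (L : κ → (S → ℂ) →ₗ[ℂ] (S₁ → ℂ)) (hL : ∀ α, ∑ k, nsq (L k α) = nsq α)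
    (hT : ∀ t α β, T t α β = ∑ k, T' k t (L k α) β) : FailsAtLeast c q T := by
  intro v w
  have h1 := Finset.sum_le_sum fun k (_ : k ∈ Finset.univ) => h k (fun i => L k (v i)) w
  rw [← Finset.mul_sum, Finset.sum_comm] at h1
  simp only [domL_map, ← Finset.mul_sum, Finset.sum_sub_distrib, ← Finset.sum_mul, hL, ← hT] at h1
  refine le_trans (mul_le_mul_of_nonneg_left ?_ hc) h1
  have := potential_sum_left (x := fun k i => nsq (L k (v i))) (y := fun i => nsq (w i))
    (fun _ _ => nsq_nonneg _) fun _ => nsq_nonneg _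
  simpa only [hL] using this

lemma FailsAtLeast.right {κ S S' S₁ : Type} [Fintype κ] [Fintype S] [Fintype S'] [Fintype S₁]
    {c : ℝ} (hc : 0 ≤ c) {q : Fin 4 × Bool → ℝ} {T : Fin 4 × Bool → (S → ℂ) → (S' → ℂ) → ℝ}
    {T' : κ → Fin 4 × Bool → (S → ℂ) → (S₁ → ℂ) → ℝ} (h : ∀ k, FailsAtLeast c q (T' k))
    (L : κ → (S' → ℂ) →ₗ[ℂ] (S₁ → ℂ)) (hL : ∀ α, ∑ k, nsq (L k α) = nsq α)
    (hT : ∀ t α β, T t α β = ∑ k, T' k t α (L k β)) : FailsAtLeast c q T := by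
  intro v w
  have h1 := Finset.sum_le_sum fun k (_ : k ∈ Finset.univ) => h k v (fun i => L k (w i))
  rw [← Finset.mul_sum, Finset.sum_comm] at h1
  simp only [domR_map, ← Finset.mul_sum, Finset.sum_sub_distrib, hL, ← hT] at h1
  refine le_trans (mul_le_mul_of_nonneg_left ?_ hc) h1
  have := potential_sum_right (x := fun i => nsq (v i)) (y := fun k i => nsq (L k (w i)))
    (fun _ => nsq_nonneg _) fun _ _ => nsq_nonneg _
  simpa only [hL] using this

-- The base case: one announcement is correct for at most one domino state, and the factor 4 in `hq`
-- absorbs the one in `potential_le`.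
open Classical in
lemma failsAtLeast_announce {Ω S S' : Type} [Fintype S] [Fintype S'] {c : ℝ} (hc : 0 ≤ c)
    {q : Fin 4 × Bool → ℝ} (hq : ∀ t, 4 * c ≤ q t) (lab : Fin 4 × Bool → Ω)
    (hlab : Function.Injective lab) (ω : Ω) :
    FailsAtLeast c q
      (fun t (α : S → ℂ) (β : S' → ℂ) => if ω = lab t then nsq α * nsq β else 0) := by
  intro v w
  obtain ⟨t₀, ht₀⟩ : ∃ t₀, ∀ t, t ≠ t₀ → ω ≠ lab t := by
    by_cases h : ∃ t, ω = lab t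
    · obtain ⟨t₀, rfl⟩ := h
      exact ⟨t₀, fun t ht h => ht (hlab h.symm)⟩
    -- If the announced label belongs to no domino state, any state may be the exempted one.
    · exact ⟨(0, true), fun t _ ht => h ⟨t, ht⟩⟩
  have h0 : ∀ t, 0 ≤ nsq (domL v t) * nsq (domR w t) :=
    fun t => mul_nonneg (nsq_nonneg _) (nsq_nonneg _)
  calc _ ≤ c * (4 * ∑ t ∈ Finset.univ.erase t₀, nsq (domL v t) * nsq (domR w t)) :=
        mul_le_mul_of_nonneg_left (potential_le v w t₀) hc
    _ = ∑ t ∈ Finset.univ.erase t₀, 4 * c * (nsq (domL v t) * nsq (domR w t)) := by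
        rw [← Finset.mul_sum]; ring
    _ ≤ ∑ t ∈ Finset.univ.erase t₀, q t * (nsq (domL v t) * nsq (domR w t) -
          if ω = lab t then nsq (domL v t) * nsq (domR w t) else 0) := by
        refine Finset.sum_le_sum fun t ht => ?_
        rw [if_neg (ht₀ t (Finset.ne_of_mem_erase ht)), sub_zero]
        exact mul_le_mul_of_nonneg_right (hq t) (h0 t)
    _ ≤ _ := by
        refine Finset.sum_le_sum_of_subset_of_nonneg (Finset.erase_subset _ _) fun t _ _ => ?_
        refine mul_nonneg (by linarith [hq t]) ?_
        split_ifs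
        · simp
        · simpa using h0 t

/-! ### Merging two of the three parties -/

/-- `K ⊗ 1` as a linear map. -/
def mapFst {A A' B : Type} [Fintype A] (K : Matrix A' A ℂ) : (A × B → ℂ) →ₗ[ℂ] (A' × B → ℂ) where
  toFun α x := ∑ u, K x.1 u * α (u, x.2)
  map_add' α β := by ext x; simp [mul_add, Finset.sum_add_distrib]
  map_smul' r α := by ext x; simp [Finset.mul_sum, mul_left_comm]

/-- `1 ⊗ K` as a linear map. -/
def mapSnd {A B B' : Type} [Fintype B] (K : Matrix B' B ℂ) : (A × B → ℂ) →ₗ[ℂ] (A × B' → ℂ) where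
  toFun α x := ∑ u, K x.2 u * α (x.1, u)
  map_add' α β := by ext x; simp [mul_add, Finset.sum_add_distrib]
  map_smul' r α := by ext x; simp [Finset.mul_sum, mul_left_comm]

lemma IsMeasurement.sum_nsq_mulVec {κ A A' : Type} [Fintype κ] [Fintype A] [Fintype A']
    {K : κ → Matrix A' A ℂ} (hK : IsMeasurement K) (α : A → ℂ) :
    ∑ k, nsq (Matrix.mulVecLin (K k) α) = nsq α := hK.sum_nsq α

lemma IsMeasurement.sum_nsq_mapFst {κ A A' B : Type} [Fintype κ] [Fintype A] [Fintype A']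
    [Fintype B] {K : κ → Matrix A' A ℂ} (hK : IsMeasurement K) (α : A × B → ℂ) :
    ∑ k, nsq (mapFst (K k) α) = nsq α := by
  unfold nsq
  rw [Fintype.sum_prod_type_right]
  simp_rw [Fintype.sum_prod_type_right (α₁ := A')]
  rw [Finset.sum_comm]
  exact Finset.sum_congr rfl fun y _ => hK.sum_nsq fun u => α (u, y)

lemma IsMeasurement.sum_nsq_mapSnd {κ A B B' : Type} [Fintype κ] [Fintype A] [Fintype B]
    [Fintype B'] {K : κ → Matrix B' B ℂ} (hK : IsMeasurement K) (α : A × B → ℂ) :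
    ∑ k, nsq (mapSnd (K k) α) = nsq α := by
  simp only [nsq, Fintype.sum_prod_type]
  rw [Finset.sum_comm]
  exact Finset.sum_congr rfl fun y _ => hK.sum_nsq fun u => α (y, u)

/-- The vector `α ⊗ γ`, with `α` held by Alice and Bob. -/
def joinAB {A B C : Type} (α : A × B → ℂ) (γ : C → ℂ) : A × B × C → ℂ :=
  fun x => α (x.1, x.2.1) * γ x.2.2

/-- The vector `α ⊗ β`, with `β` held by Bob and Charlie. -/
def joinBC {A B C : Type} (α : A → ℂ) (β : B × C → ℂ) : A × B × C → ℂ :=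
  fun x => α x.1 * β x.2

/-- The vector `α ⊗ β`, with `α` held by Alice and Charlie. -/
def joinAC {A B C : Type} (α : A × C → ℂ) (β : B → ℂ) : A × B × C → ℂ :=
  fun x => α (x.1, x.2.2) * β x.2.1

section
variable {A B C D : Type}

lemma nsq_mul_of_equiv {X S S' : Type} [Fintype X] [Fintype S] [Fintype S'] (e : X ≃ S × S')
    {ψ : X → ℂ} (α : S → ℂ) (β : S' → ℂ) (h : ∀ x, ψ x = α (e x).1 * β (e x).2) :
    nsq ψ = nsq α * nsq β := by
  simp only [nsq, Finset.sum_mul_sum]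
  rw [← Fintype.sum_prod_type' fun i j => Complex.normSq (α i) * Complex.normSq (β j)]
  exact Fintype.sum_equiv e _ _ fun x => by rw [h, Complex.normSq_mul]

lemma nsq_joinAB [Fintype A] [Fintype B] [Fintype C] (α : A × B → ℂ) (γ : C → ℂ) :
    nsq (joinAB α γ) = nsq α * nsq γ :=
  nsq_mul_of_equiv (Equiv.prodAssoc A B C).symm α γ fun _ => rfl

lemma nsq_joinBC [Fintype A] [Fintype B] [Fintype C] (α : A → ℂ) (β : B × C → ℂ) :
    nsq (joinBC α β) = nsq α * nsq β :=
  nsq_mul_of_equiv (Equiv.refl _) α β fun _ => rfl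

lemma nsq_joinAC [Fintype A] [Fintype B] [Fintype C] (α : A × C → ℂ) (β : B → ℂ) :
    nsq (joinAC α β) = nsq α * nsq β :=
  nsq_mul_of_equiv
    { toFun := fun x => ((x.1, x.2.2), x.2.1)
      invFun := fun y => (y.1.1, y.2, y.1.2)
      left_inv := fun _ => rfl
      right_inv := fun _ => rfl } α β fun _ => rfl

lemma vecA_joinAB [Fintype A] (K : Matrix D A ℂ) (α : A × B → ℂ) (γ : C → ℂ) :
    vecA K (joinAB α γ) = joinAB (mapFst K α) γ := by
  ext x; simp [vecA, joinAB, mapFst, Finset.sum_mul, mul_assoc]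

lemma vecB_joinAB [Fintype B] (K : Matrix D B ℂ) (α : A × B → ℂ) (γ : C → ℂ) :
    vecB K (joinAB α γ) = joinAB (mapSnd K α) γ := by
  ext x; simp [vecB, joinAB, mapSnd, Finset.sum_mul, mul_assoc]

lemma vecC_joinAB [Fintype C] (K : Matrix D C ℂ) (α : A × B → ℂ) (γ : C → ℂ) :
    vecC K (joinAB α γ) = joinAB α (Matrix.mulVecLin K γ) := by
  ext x
  simp [vecC, joinAB, Matrix.mulVec, dotProduct, Finset.mul_sum, mul_left_comm]

lemma vecA_joinBC [Fintype A] (K : Matrix D A ℂ) (α : A → ℂ) (β : B × C → ℂ) :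
    vecA K (joinBC α β) = joinBC (Matrix.mulVecLin K α) β := by
  ext x
  simp [vecA, joinBC, Matrix.mulVec, dotProduct, Finset.sum_mul, mul_assoc]

lemma vecB_joinBC [Fintype B] (K : Matrix D B ℂ) (α : A → ℂ) (β : B × C → ℂ) :
    vecB K (joinBC α β) = joinBC α (mapFst K β) := by
  ext x; simp [vecB, joinBC, mapFst, Finset.mul_sum, mul_left_comm]

lemma vecC_joinBC [Fintype C] (K : Matrix D C ℂ) (α : A → ℂ) (β : B × C → ℂ) :
    vecC K (joinBC α β) = joinBC α (mapSnd K β) := by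
  ext x; simp [vecC, joinBC, mapSnd, Finset.mul_sum, mul_left_comm]

lemma vecA_joinAC [Fintype A] (K : Matrix D A ℂ) (α : A × C → ℂ) (β : B → ℂ) :
    vecA K (joinAC α β) = joinAC (mapFst K α) β := by
  ext x; simp [vecA, joinAC, mapFst, Finset.sum_mul, mul_assoc]

lemma vecB_joinAC [Fintype B] (K : Matrix D B ℂ) (α : A × C → ℂ) (β : B → ℂ) :
    vecB K (joinAC α β) = joinAC α (Matrix.mulVecLin K β) := by
  ext x
  simp [vecB, joinAC, Matrix.mulVec, dotProduct, Finset.mul_sum, mul_left_comm]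

lemma vecC_joinAC [Fintype C] (K : Matrix D C ℂ) (α : A × C → ℂ) (β : B → ℂ) :
    vecC K (joinAC α β) = joinAC (mapSnd K α) β := by
  ext x; simp [vecC, joinAC, mapSnd, Finset.sum_mul, mul_assoc]

end

section

variable {Ω : Type} {c : ℝ} {q : Fin 4 × Bool → ℝ} {lab : Fin 4 × Bool → Ω}

/-- A local step of either merged party is a step of the merged one, so the bipartite induction
covers three-party protocols. -/
lemma failsAtLeast_joinAB (hc : 0 ≤ c) (hq : ∀ t, 4 * c ≤ q t) (hlab : Function.Injective lab)
    {A B C : Type} (P : LOCC Ω A B C) : ∀ [Fintype A] [Fintype B] [Fintype C],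
    FailsAtLeast c q fun t (α : A × B → ℂ) (γ : C → ℂ) => P.vprob (lab t) (joinAB α γ) := by
  induction P with
  | announce ω =>
    intro _ _ _
    simpa only [vprob_announce, nsq_joinAB] using failsAtLeast_announce hc hq lab hlab ω
  | alice κ A' K hK next ih =>
    intro _ _ _
    exact FailsAtLeast.left hc (fun k => ih k) (fun k => mapFst (K k)) hK.sum_nsq_mapFst
      fun t α β => by simp only [vprob_alice, vecA_joinAB]
  | bob κ A' K hK next ih =>
    intro _ _ _
    exact FailsAtLeast.left hc (fun k => ih k) (fun k => mapSnd (K k)) hK.sum_nsq_mapSnd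
      fun t α β => by simp only [vprob_bob, vecB_joinAB]
  | charlie κ A' K hK next ih =>
    intro _ _ _
    exact FailsAtLeast.right hc (fun k => ih k) (fun k => (K k).mulVecLin) hK.sum_nsq_mulVec
      fun t α β => by simp only [vprob_charlie, vecC_joinAB]

lemma failsAtLeast_joinBC (hc : 0 ≤ c) (hq : ∀ t, 4 * c ≤ q t) (hlab : Function.Injective lab)
    {A B C : Type} (P : LOCC Ω A B C) : ∀ [Fintype A] [Fintype B] [Fintype C],
    FailsAtLeast c q fun t (α : A → ℂ) (β : B × C → ℂ) => P.vprob (lab t) (joinBC α β) := by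
  induction P with
  | announce ω =>
    intro _ _ _
    simpa only [vprob_announce, nsq_joinBC] using failsAtLeast_announce hc hq lab hlab ω
  | alice κ A' K hK next ih =>
    intro _ _ _
    exact FailsAtLeast.left hc (fun k => ih k) (fun k => (K k).mulVecLin) hK.sum_nsq_mulVec
      fun t α β => by simp only [vprob_alice, vecA_joinBC]
  | bob κ A' K hK next ih =>
    intro _ _ _
    exact FailsAtLeast.right hc (fun k => ih k) (fun k => mapFst (K k)) hK.sum_nsq_mapFst
      fun t α β => by simp only [vprob_bob, vecB_joinBC]
  | charlie κ A' K hK next ih =>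
    intro _ _ _
    exact FailsAtLeast.right hc (fun k => ih k) (fun k => mapSnd (K k)) hK.sum_nsq_mapSnd
      fun t α β => by simp only [vprob_charlie, vecC_joinBC]

lemma failsAtLeast_joinAC (hc : 0 ≤ c) (hq : ∀ t, 4 * c ≤ q t) (hlab : Function.Injective lab)
    {A B C : Type} (P : LOCC Ω A B C) : ∀ [Fintype A] [Fintype B] [Fintype C],
    FailsAtLeast c q fun t (α : A × C → ℂ) (β : B → ℂ) => P.vprob (lab t) (joinAC α β) := by
  induction P with
  | announce ω =>
    intro _ _ _
    simpa only [vprob_announce, nsq_joinAC] using failsAtLeast_announce hc hq lab hlab ω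
  | alice κ A' K hK next ih =>
    intro _ _ _
    exact FailsAtLeast.left hc (fun k => ih k) (fun k => mapFst (K k)) hK.sum_nsq_mapFst
      fun t α β => by simp only [vprob_alice, vecA_joinAC]
  | bob κ A' K hK next ih =>
    intro _ _ _
    exact FailsAtLeast.right hc (fun k => ih k) (fun k => (K k).mulVecLin) hK.sum_nsq_mulVec
      fun t α β => by simp only [vprob_bob, vecB_joinAC]
  | charlie κ A' K hK next ih =>
    intro _ _ _
    exact FailsAtLeast.left hc (fun k => ih k) (fun k => mapSnd (K k)) hK.sum_nsq_mapSnd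
      fun t α β => by simp only [vprob_charlie, vecC_joinAC]

end

/-! ### Attaching a resource; from failure bounds to payoffs -/

/-- The vector `ζ ⊗ r`, each party holding its part of both. -/
def attach {A B C RA RB RC : Type} (ζ : A × B × C → ℂ) (r : RA × RB × RC → ℂ) :
    (A × RA) × (B × RB) × (C × RC) → ℂ :=
  fun x => ζ (x.1.1, x.2.1.1, x.2.2.1) * r (x.1.2, x.2.1.2, x.2.2.2)

lemma withResource_proj {A B C RA RB RC : Type} (ζ : A × B × C → ℂ) (r : RA × RB × RC → ℂ) :
    withResource (proj ζ) (proj r) = proj (attach ζ r) := by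
  ext x y
  simp [withResource, proj, attach, Matrix.vecMulVec_apply]
  ring

lemma withResource_sum {ι A B C RA RB RC : Type} [Fintype ι]
    (σ : Matrix (A × B × C) (A × B × C) ℂ)
    (ρ : ι → Matrix (RA × RB × RC) (RA × RB × RC) ℂ) :
    withResource σ (∑ l, ρ l) = ∑ l, withResource σ (ρ l) := by
  ext x y
  simp [withResource, Matrix.sum_apply, Finset.mul_sum]

lemma nsq_attach {A B C RA RB RC : Type} [Fintype A] [Fintype B] [Fintype C] [Fintype RA]
    [Fintype RB] [Fintype RC] (ζ : A × B × C → ℂ) (r : RA × RB × RC → ℂ) :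
    nsq (attach ζ r) = nsq ζ * nsq r :=
  nsq_mul_of_equiv
    { toFun := fun x => ((x.1.1, x.2.1.1, x.2.2.1), (x.1.2, x.2.1.2, x.2.2.2))
      invFun := fun y => ((y.1.1, y.2.1), (y.1.2.1, y.2.2.1), (y.1.2.2, y.2.2.2))
      left_inv := fun _ => rfl
      right_inv := fun _ => rfl } ζ r fun _ => rfl

lemma nsq_prod3 {A B C : Type} [Fintype A] [Fintype B] [Fintype C] (a : A → ℂ) (b : B → ℂ)
    (c : C → ℂ) : nsq (prod3 a b c) = nsq a * nsq b * nsq c := by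
  rw [mul_assoc, ← nsq_mul_of_equiv (Equiv.refl (B × C)) b c fun _ => rfl]
  exact nsq_mul_of_equiv (Equiv.refl _) _ _ fun _ => mul_assoc _ _ _

lemma nsq_ket {A : Type} [Fintype A] [DecidableEq A] (i : A) : nsq (ket i) = 1 := by
  simp [nsq, ket, Pi.single_apply, apply_ite Complex.normSq]

lemma nsq_pm {A : Type} [Fintype A] [DecidableEq A] {i j : A} (hij : i ≠ j) (s : Bool) :
    nsq (pm i j s) = 1 := by
  have h : ∀ x, Complex.normSq (pm i j s x) =
      1 / 2 * ((if x = i then 1 else 0) + if x = j then 1 else 0) := by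
    intro x
    simp only [pm, ket, Pi.smul_apply, Pi.add_apply, smul_eq_mul, Complex.normSq_mul,
      normSq_inv_sqrt_two, Pi.single_apply]
    by_cases h1 : x = i
    · simp [h1, hij]
    · by_cases h2 : x = j
      · cases s <;> simp [h2, hij.symm, sgn]
      · simp [h1, h2]
  simp only [nsq, h, ← Finset.mul_sum, Finset.sum_add_distrib]
  simp
  norm_num

lemma nsq_zeta (i : Label) : nsq (zeta i) = 1 := by
  obtain ⟨j, s⟩ := i
  fin_cases j <;> simp [zeta, nsq_prod3, nsq_ket, nsq_pm]

section
variable {RA RB RC ι : Type} [Fintype RA] [Fintype RB] [Fintype RC] [Fintype ι]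

lemma success_eq (p : Label → ℝ) (r : ι → RA × RB × RC → ℂ)
    (P : LOCC Label (Fin 4 × RA) (Fin 3 × RB) (Fin 3 × RC)) :
    success p (∑ l, proj (r l)) P =
      ∑ l, ∑ i, p i * P.vprob i (attach (zeta i) (r l)) := by
  simp only [success, withResource_sum, prob_sum, withResource_proj, Finset.mul_sum]
  rw [Finset.sum_comm]
  rfl

/-- The states outside the range of `lab` can only add to the failure probability, so a bound on the
eight domino states suffices, one resource component at a time. -/
lemma success_le_of_fails {p : Label → ℝ} (hp : ∀ i, 0 < p i) (hp1 : ∑ i, p i = 1) {c : ℝ}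
    {r : ι → RA × RB × RC → ℂ} (hr : ∑ l, nsq (r l) = 1) {lab : Fin 4 × Bool → Label}
    (hlab : Function.Injective lab) (P : LOCC Label (Fin 4 × RA) (Fin 3 × RB) (Fin 3 × RC))
    (h : ∀ l, c * nsq (r l) ≤ ∑ t, p (lab t) * (nsq (attach (zeta (lab t)) (r l)) -
      P.vprob (lab t) (attach (zeta (lab t)) (r l)))) :
    success p (∑ l, proj (r l)) P ≤ 1 - c := by
  have key : ∀ l, ∑ i, p i * P.vprob i (attach (zeta i) (r l)) ≤ nsq (r l) - c * nsq (r l) := by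
    intro l
    have h1 : ∑ t, p (lab t) * (nsq (attach (zeta (lab t)) (r l)) -
        P.vprob (lab t) (attach (zeta (lab t)) (r l))) ≤
        ∑ i, p i * (nsq (attach (zeta i) (r l)) - P.vprob i (attach (zeta i) (r l))) := by
      rw [← Finset.sum_image (s := Finset.univ) (g := lab)
        (f := fun i => p i * (nsq (attach (zeta i) (r l)) - P.vprob i (attach (zeta i) (r l))))
        (fun a _ b _ hab => hlab hab)]
      exact Finset.sum_le_sum_of_subset_of_nonneg (Finset.subset_univ _) fun i _ _ =>
        mul_nonneg (hp i).le (sub_nonneg.mpr (vprob_le _ _ _))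
    have h2 := (h l).trans h1
    simp only [mul_sub, nsq_attach, nsq_zeta, one_mul, Finset.sum_sub_distrib,
      ← Finset.sum_mul, hp1] at h2
    linarith
  rw [success_eq]
  refine (Finset.sum_le_sum fun l _ => key l).trans_eq ?_
  rw [Finset.sum_sub_distrib, ← Finset.mul_sum, hr]
  ring

lemma payoff_le_of_fails {p : Label → ℝ} (hp : ∀ i, 0 < p i) (hp1 : ∑ i, p i = 1) {c : ℝ}
    {r : ι → RA × RB × RC → ℂ} (hr : ∑ l, nsq (r l) = 1) {lab : Fin 4 × Bool → Label}
    (hlab : Function.Injective lab)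
    (h : ∀ (P : LOCC Label (Fin 4 × RA) (Fin 3 × RB) (Fin 3 × RC)) l,
      c * nsq (r l) ≤ ∑ t, p (lab t) * (nsq (attach (zeta (lab t)) (r l)) -
        P.vprob (lab t) (attach (zeta (lab t)) (r l)))) :
    payoff p (∑ l, proj (r l)) ≤ 1 - c := by
  -- Bounding a real supremum by `ciSup_le` needs at least one protocol.
  have : Nonempty (LOCC Label (Fin 4 × RA) (Fin 3 × RB) (Fin 3 × RC)) :=
    ⟨LOCC.announce (0, true)⟩
  exact ciSup_le fun P => success_le_of_fails hp hp1 hr hlab P (h P)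

end

/-- The starting point of every protocol: equal weights are balanced, and the plateau is `3 * a * (3
* b) / 500`. -/
lemma le_potential_const {a b : ℝ} (ha : 0 ≤ a) (hb : 0 ≤ b) :
    9 / 500 * (a * b) ≤ potential (fun _ => a) (fun _ => b) := by
  refine le_trans (le_of_eq ?_) (le_potential_left (fun _ => ha) (fun _ => hb) fun _ => ?_)
  · simp; ring
  · simp; linarith

open scoped MatrixOrder Matrix.Norms.L2Operator in
/-- A density operator is a sum of projectors on unnormalized vectors. -/
lemma IsDensity.exists_sum_proj {X : Type} [Fintype X] {ρ : Matrix X X ℂ} (hρ : IsDensity ρ) :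
    ∃ r : X → X → ℂ, ρ = ∑ l, proj (r l) ∧ ∑ l, nsq (r l) = 1 := by
  classical
  -- The conjugated rows of a factor `B` with `ρ = B† B` are the required vectors.
  obtain ⟨B, hB⟩ := CStarAlgebra.nonneg_iff_eq_star_mul_self.mp hρ.1.nonneg
  have h : ρ = ∑ l, proj (fun x => star (B l x)) := by
    ext x y
    rw [hB, Matrix.star_eq_conjTranspose]
    simp [Matrix.mul_apply, Matrix.sum_apply, proj, Matrix.vecMulVec_apply]
  refine ⟨fun l x => star (B l x), h, ?_⟩
  have := congrArg Complex.re hρ.2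
  rw [h, Matrix.trace_sum, Complex.re_sum] at this
  simpa only [trace_proj, Complex.one_re] using this

lemma exists_prior_bound {p : Label → ℝ} (hp : ∀ i, 0 < p i) : ∃ c > 0, ∀ i, 4 * c ≤ p i := by
  obtain ⟨i₀, h⟩ := Finite.exists_min p
  exact ⟨p i₀ / 4, by linarith [hp i₀], fun i => by linarith [h i]⟩

/-! ### Two-party resources have payoff below 1 -/

/-- The labels of the eight domino states of Alice and Charlie. -/
def labAC (t : Fin 4 × Bool) : Label := (![0, 4, 5, 6] t.1, t.2)

/-- The labels of the eight domino states of Alice and Bob. -/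
def labAB (t : Fin 4 × Bool) : Label := (![0, 1, 2, 3] t.1, t.2)

lemma labAC_injective : Function.Injective labAC := by decide

lemma labAB_injective : Function.Injective labAB := by decide

section

variable {D E : Type}

/-- In the pairs of `labAC` Bob's register is constantly `ket 2`, so it and the resource are
absorbed into the left vectors. Alice's three basis states here are |p⟩, |q⟩, |2⟩, whence `![0, 1,
3]`. -/
lemma attach_eq_joinAB (r : D × E × Unit → ℂ) (t : Fin 4 × Bool) :
    attach (zeta (labAC t)) r = joinAB
      (domL (fun i (x : (Fin 4 × D) × (Fin 3 × E)) =>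
        ket (![0, 1, 3] i) x.1.1 * ket 2 x.2.1 * r (x.1.2, x.2.2, ())) t)
      (domR (fun i (x : Fin 3 × Unit) => ket i x.1) t) := by
  obtain ⟨j, s⟩ := t
  ext ⟨⟨a, d⟩, ⟨b, e⟩, ⟨c, u⟩⟩
  fin_cases j <;> simp [attach, zeta, labAC, joinAB, domL, domR, mix, pm, prod3] <;> ring

/-- Here Charlie's register is the constant one, and the resource goes to the right side with Bob.
-/
lemma attach_eq_joinBC (r : Unit × D × E → ℂ) (t : Fin 4 × Bool) :
    attach (zeta (labAB t)) r = joinBC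
      (domL (fun i (x : Fin 4 × Unit) => ket (![0, 1, 2] i) x.1) t)
      (domR (fun i (x : (Fin 3 × D) × (Fin 3 × E)) =>
        ket i x.1.1 * ket 2 x.2.1 * r ((), x.1.2, x.2.2)) t) := by
  obtain ⟨j, s⟩ := t
  ext ⟨⟨a, u⟩, ⟨b, d⟩, ⟨c, e⟩⟩
  fin_cases j <;> simp [attach, zeta, labAB, joinBC, domL, domR, mix, pm, prod3] <;> ring

lemma attach_eq_joinAC (r : D × Unit × E → ℂ) (t : Fin 4 × Bool) :
    attach (zeta (labAB t)) r = joinAC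
      (domL (fun i (x : (Fin 4 × D) × (Fin 3 × E)) =>
        ket (![0, 1, 2] i) x.1.1 * ket 2 x.2.1 * r (x.1.2, (), x.2.2)) t)
      (domR (fun i (x : Fin 3 × Unit) => ket i x.1) t) := by
  obtain ⟨j, s⟩ := t
  ext ⟨⟨a, d⟩, ⟨b, u⟩, ⟨c, e⟩⟩
  fin_cases j <;> simp [attach, zeta, labAB, joinAC, domL, domR, mix, pm, prod3] <;> ring

variable [Fintype D] [Fintype E]

lemma nsq_ket_fst {A : Type} [Fintype A] [DecidableEq A] (i : A) :
    nsq (fun x : A × Unit => ket i x.1) = 1 := by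
  rw [nsq, Fintype.sum_prod_type]
  simp [ket, Pi.single_apply, apply_ite Complex.normSq]

lemma nsq_ket_mul {A B : Type} [Fintype A] [DecidableEq A] [Fintype B] [DecidableEq B] (i : A)
    (j : B) (r : D × E → ℂ) :
    nsq (fun x : (A × D) × (B × E) => ket i x.1.1 * ket j x.2.1 * r (x.1.2, x.2.2)) = nsq r := by
  simp [nsq, Fintype.sum_prod_type, ket, Pi.single_apply, apply_ite Complex.normSq,
    ite_mul, Finset.sum_ite_irrel]

lemma payoff_sharedAB_lt {p : Label → ℝ} (hp : ∀ i, 0 < p i) (hp1 : ∑ i, p i = 1)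
    {ρ : Matrix (D × E) (D × E) ℂ} (hρ : IsDensity ρ) : payoff p (sharedAB ρ) < 1 := by
  obtain ⟨r, hr, hr1⟩ := hρ.exists_sum_proj
  obtain ⟨c, hc, hcp⟩ := exists_prior_bound hp
  have e : sharedAB ρ = ∑ l, proj (fun x : D × E × Unit => r l (x.1, x.2.1)) := by
    ext x y
    simp [hr, sharedAB, Matrix.sum_apply, proj, Matrix.vecMulVec_apply]
  have hn : ∀ l, nsq (fun x : D × E × Unit => r l (x.1, x.2.1)) = nsq (r l) := fun l => by
    simp [nsq, Fintype.sum_prod_type]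
  rw [e]
  refine lt_of_le_of_lt (payoff_le_of_fails (c := c * (9 / 500)) hp hp1 (by simpa only [hn])
    labAC_injective fun P l => ?_) (by linarith)
  have := failsAtLeast_joinAB hc.le (fun t => hcp (labAC t)) labAC_injective P
    (fun i x => ket (![0, 1, 3] i) x.1.1 * ket 2 x.2.1 * r l (x.1.2, x.2.2))
    (fun i x => ket i x.1)
  simp only [← nsq_joinAB, ← attach_eq_joinAB (fun x => r l (x.1, x.2.1))] at this
  refine le_trans ?_ this
  rw [mul_assoc]
  refine mul_le_mul_of_nonneg_left ?_ hc.le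
  simp only [nsq_ket_fst, nsq_ket_mul, hn]
  simpa using le_potential_const (nsq_nonneg (r l)) zero_le_one

lemma payoff_sharedBC_lt {p : Label → ℝ} (hp : ∀ i, 0 < p i) (hp1 : ∑ i, p i = 1)
    {ρ : Matrix (D × E) (D × E) ℂ} (hρ : IsDensity ρ) : payoff p (sharedBC ρ) < 1 := by
  obtain ⟨r, hr, hr1⟩ := hρ.exists_sum_proj
  obtain ⟨c, hc, hcp⟩ := exists_prior_bound hp
  have e : sharedBC ρ = ∑ l, proj (fun x : Unit × D × E => r l x.2) := by
    ext x y
    simp [hr, sharedBC, Matrix.sum_apply, proj, Matrix.vecMulVec_apply]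
  have hn : ∀ l, nsq (fun x : Unit × D × E => r l x.2) = nsq (r l) := fun l => by
    simp [nsq, Fintype.sum_prod_type]
  rw [e]
  refine lt_of_le_of_lt (payoff_le_of_fails (c := c * (9 / 500)) hp hp1 (by simpa only [hn])
    labAB_injective fun P l => ?_) (by linarith)
  have := failsAtLeast_joinBC hc.le (fun t => hcp (labAB t)) labAB_injective P
    (fun i x => ket (![0, 1, 2] i) x.1)
    (fun i x => ket i x.1.1 * ket 2 x.2.1 * r l (x.1.2, x.2.2))
  simp only [← nsq_joinBC, ← attach_eq_joinBC (fun x => r l x.2)] at this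
  refine le_trans ?_ this
  rw [mul_assoc]
  refine mul_le_mul_of_nonneg_left ?_ hc.le
  simp only [nsq_ket_fst, nsq_ket_mul, hn]
  simpa using le_potential_const zero_le_one (nsq_nonneg (r l))

lemma payoff_sharedAC_lt {p : Label → ℝ} (hp : ∀ i, 0 < p i) (hp1 : ∑ i, p i = 1)
    {ρ : Matrix (D × E) (D × E) ℂ} (hρ : IsDensity ρ) : payoff p (sharedAC ρ) < 1 := by
  obtain ⟨r, hr, hr1⟩ := hρ.exists_sum_proj
  obtain ⟨c, hc, hcp⟩ := exists_prior_bound hp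
  have e : sharedAC ρ = ∑ l, proj (fun x : D × Unit × E => r l (x.1, x.2.2)) := by
    ext x y
    simp [hr, sharedAC, Matrix.sum_apply, proj, Matrix.vecMulVec_apply]
  have hn : ∀ l, nsq (fun x : D × Unit × E => r l (x.1, x.2.2)) = nsq (r l) := fun l => by
    simp [nsq, Fintype.sum_prod_type]
  rw [e]
  refine lt_of_le_of_lt (payoff_le_of_fails (c := c * (9 / 500)) hp hp1 (by simpa only [hn])
    labAB_injective fun P l => ?_) (by linarith)
  have := failsAtLeast_joinAC hc.le (fun t => hcp (labAB t)) labAB_injective P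
    (fun i x => ket (![0, 1, 2] i) x.1.1 * ket 2 x.2.1 * r l (x.1.2, x.2.2))
    (fun i x => ket i x.1)
  simp only [← nsq_joinAC, ← attach_eq_joinAC (fun x => r l (x.1, x.2.2))] at this
  refine le_trans ?_ this
  rw [mul_assoc]
  refine mul_le_mul_of_nonneg_left ?_ hc.le
  simp only [nsq_ket_fst, nsq_ket_mul, hn]
  simpa using le_potential_const (nsq_nonneg (r l)) zero_le_one

end

/-! ### Perfect identification by value and sign measurements -/

/-- The protocol always answers `i` on the pure state `ψ`. -/
def Identifies {Ω A B C : Type} [Fintype A] [Fintype B] [Fintype C] (P : LOCC Ω A B C) (i : Ω)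
    (ψ : A × B × C → ℂ) : Prop := P.vprob i ψ = nsq ψ

/-- The projective measurement of the value of `g` in the computational basis. -/
def valueMeas {κ A : Type} [DecidableEq κ] [DecidableEq A] (g : A → κ) (k : κ) : Matrix A A ℂ :=
  Matrix.diagonal fun a => if g a = k then 1 else 0

lemma isMeasurement_valueMeas {κ A : Type} [DecidableEq κ] [DecidableEq A] [Fintype κ] [Fintype A]
    (g : A → κ) : IsMeasurement (valueMeas g) := by
  unfold IsMeasurement
  ext x y
  simp only [valueMeas, Matrix.diagonal_conjTranspose, Matrix.diagonal_mul_diagonal,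
    Matrix.sum_apply, Matrix.diagonal_apply, Matrix.one_apply]
  by_cases h : x = y <;> simp [h]

/-- The matrix of a permutation of the computational basis. -/
def permOp {A : Type} [DecidableEq A] (σ : A → A) : Matrix A A ℂ :=
  Matrix.of fun x u => if u = σ x then 1 else 0

/-- The measurement of the eigenvalue `±1` of an involution of the computational basis. -/
def signMeas {A : Type} [DecidableEq A] (σ : A → A) (t : Bool) : Matrix A A ℂ :=
  (1 / 2 : ℂ) • (1 + sgn t • permOp σ)

lemma isMeasurement_signMeas {A : Type} [DecidableEq A] [Fintype A] {σ : A → A}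
    (hσ : Function.Involutive σ) : IsMeasurement (signMeas σ) := by
  have hH : (permOp σ)ᴴ = permOp σ := by
    ext x y
    have : x = σ y ↔ y = σ x := ⟨fun h => by rw [h, hσ], fun h => by rw [h, hσ]⟩
    simp [permOp, this, apply_ite]
  have hM : permOp σ * permOp σ = 1 := by
    ext x y
    simp only [permOp, Matrix.mul_apply, Matrix.of_apply, ite_mul, one_mul, zero_mul,
      Finset.sum_ite_eq', Finset.mem_univ, if_true, hσ x, Matrix.one_apply, eq_comm (a := y)]
  have hK : ∀ t, (signMeas σ t)ᴴ = signMeas σ t := by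
    intro t
    cases t <;> simp [signMeas, sgn, hH, Matrix.conjTranspose_smul]
  have hsum : signMeas σ true * signMeas σ true + signMeas σ false * signMeas σ false = 1 := by
    simp only [signMeas, sgn, if_true, Bool.false_eq_true, if_false, Matrix.smul_mul,
      Matrix.mul_smul, add_mul, mul_add, hM, one_mul, mul_one]
    module
  rw [IsMeasurement, Fintype.sum_bool, hK, hK, hsum]
  -- The two identity matrices differ only in their decidability instances.
  congr!

section
variable {A B C κ : Type}

lemma vecA_valueMeas [Fintype A] [DecidableEq A] [DecidableEq κ] (g : A → κ) (k : κ)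
    (ψ : A × B × C → ℂ) :
    vecA (valueMeas g k) ψ = fun x => if g x.1 = k then ψ x else 0 := by
  ext x; simp [vecA, valueMeas, Matrix.diagonal_apply]

lemma vecB_valueMeas [Fintype B] [DecidableEq B] [DecidableEq κ] (g : B → κ) (k : κ)
    (ψ : A × B × C → ℂ) :
    vecB (valueMeas g k) ψ = fun x => if g x.2.1 = k then ψ x else 0 := by
  ext x; simp [vecB, valueMeas, Matrix.diagonal_apply]

lemma vecC_valueMeas [Fintype C] [DecidableEq C] [DecidableEq κ] (g : C → κ) (k : κ)
    (ψ : A × B × C → ℂ) :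
    vecC (valueMeas g k) ψ = fun x => if g x.2.2 = k then ψ x else 0 := by
  ext x; simp [vecC, valueMeas, Matrix.diagonal_apply]

lemma vecA_signMeas [Fintype A] [DecidableEq A] (σ : A → A) (t : Bool) (ψ : A × B × C → ℂ) :
    vecA (signMeas σ t) ψ = fun x => 1 / 2 * (ψ x + sgn t * ψ (σ x.1, x.2)) := by
  ext x
  simp [vecA, signMeas, permOp, Matrix.one_apply, add_mul, mul_assoc, Finset.sum_add_distrib,
    mul_add]

lemma vecB_signMeas [Fintype B] [DecidableEq B] (σ : B → B) (t : Bool) (ψ : A × B × C → ℂ) :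
    vecB (signMeas σ t) ψ = fun x => 1 / 2 * (ψ x + sgn t * ψ (x.1, σ x.2.1, x.2.2)) := by
  ext x
  simp [vecB, signMeas, permOp, Matrix.one_apply, add_mul, mul_assoc, Finset.sum_add_distrib,
    mul_add]

lemma vecC_signMeas [Fintype C] [DecidableEq C] (σ : C → C) (t : Bool) (ψ : A × B × C → ℂ) :
    vecC (signMeas σ t) ψ = fun x => 1 / 2 * (ψ x + sgn t * ψ (x.1, x.2.1, σ x.2.2)) := by
  ext x
  simp [vecC, signMeas, permOp, Matrix.one_apply, add_mul, mul_assoc, Finset.sum_add_distrib,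
    mul_add]

end

section
variable {Ω A B C A' κ : Type} [Fintype A] [Fintype B] [Fintype C] [Fintype A'] [Fintype κ]
  {i : Ω} {ψ : A × B × C → ℂ}

lemma identifies_zero {Ω A B C : Type} [Fintype A] [Fintype B] [Fintype C] (P : LOCC Ω A B C)
    (i : Ω) : Identifies P i 0 :=
  le_antisymm (vprob_le _ _ _) (by rw [nsq_zero]; exact vprob_nonneg _ _ _)

lemma identifies_announce {Ω A B C : Type} [Fintype A] [Fintype B] [Fintype C] (i : Ω)
    (ψ : A × B × C → ℂ) : Identifies (LOCC.announce i) i ψ := by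
  rw [Identifies, vprob_announce, if_pos rfl]

lemma identifies_alice {K : κ → Matrix A' A ℂ} {hK : IsMeasurement K} {next : κ → LOCC Ω A' B C}
    (h : ∀ k, Identifies (next k) i (vecA (K k) ψ)) :
    Identifies (LOCC.alice κ A' K hK next) i ψ := by
  rw [Identifies, vprob_alice, ← hK.sum_nsq_vecA]
  exact Finset.sum_congr rfl fun k _ => h k

lemma identifies_bob {K : κ → Matrix A' B ℂ} {hK : IsMeasurement K} {next : κ → LOCC Ω A A' C}
    (h : ∀ k, Identifies (next k) i (vecB (K k) ψ)) :
    Identifies (LOCC.bob κ A' K hK next) i ψ := by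
  rw [Identifies, vprob_bob, ← hK.sum_nsq_vecB]
  exact Finset.sum_congr rfl fun k _ => h k

lemma identifies_charlie {K : κ → Matrix A' C ℂ} {hK : IsMeasurement K}
    {next : κ → LOCC Ω A B A'} (h : ∀ k, Identifies (next k) i (vecC (K k) ψ)) :
    Identifies (LOCC.charlie κ A' K hK next) i ψ := by
  rw [Identifies, vprob_charlie, ← hK.sum_nsq_vecC]
  exact Finset.sum_congr rfl fun k _ => h k

end

section
variable {Ω A B C κ : Type} [Fintype A] [Fintype B] [Fintype C] {i : Ω} {ψ : A × B × C → ℂ}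

/-- The support of `ψ` lies in one class, so the outcome `k₀` leaves `ψ` unchanged and every other
branch is zero. -/
lemma identifies_value [DecidableEq κ] {P : κ → LOCC Ω A B C} {f : A × B × C → κ} {k₀ : κ}
    (hg : ∀ x, ψ x ≠ 0 → f x = k₀) (h : Identifies (P k₀) i ψ) (k : κ) :
    Identifies (P k) i (fun x => if f x = k then ψ x else 0) := by
  by_cases hk : k = k₀
  · subst hk
    convert h using 1
    ext x
    by_cases hx : ψ x = 0
    · simp [hx]
    · simp [hg x hx]
  · convert identifies_zero (P k) i using 1
    ext x
    by_cases hx : ψ x = 0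
    · simp [hx]
    · simp [hg x hx, Ne.symm hk]

lemma identifies_alice_value [Fintype κ] [DecidableEq κ] [DecidableEq A] {g : A → κ}
    {next : κ → LOCC Ω A B C} {k₀ : κ}
    (hg : ∀ x, ψ x ≠ 0 → g x.1 = k₀) (h : Identifies (next k₀) i ψ) :
    Identifies (LOCC.alice κ A (valueMeas g) (isMeasurement_valueMeas g) next) i ψ :=
  identifies_alice fun k => by
    rw [vecA_valueMeas]; exact identifies_value (P := next) (f := fun x => g x.1) hg h k

lemma identifies_bob_value [Fintype κ] [DecidableEq κ] [DecidableEq B] {g : B → κ}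
    {next : κ → LOCC Ω A B C} {k₀ : κ}
    (hg : ∀ x, ψ x ≠ 0 → g x.2.1 = k₀) (h : Identifies (next k₀) i ψ) :
    Identifies (LOCC.bob κ B (valueMeas g) (isMeasurement_valueMeas g) next) i ψ :=
  identifies_bob fun k => by
    rw [vecB_valueMeas]; exact identifies_value (P := next) (f := fun x => g x.2.1) hg h k

lemma identifies_charlie_value [Fintype κ] [DecidableEq κ] [DecidableEq C] {g : C → κ}
    {next : κ → LOCC Ω A B C} {k₀ : κ}
    (hg : ∀ x, ψ x ≠ 0 → g x.2.2 = k₀) (h : Identifies (next k₀) i ψ) :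
    Identifies (LOCC.charlie κ C (valueMeas g) (isMeasurement_valueMeas g) next) i ψ :=
  identifies_charlie fun k => by
    rw [vecC_valueMeas]; exact identifies_value (P := next) (f := fun x => g x.2.2) hg h k

/-- An eigenvector is fixed by the projector of its own sign and killed by the other. -/
lemma identifies_sign {P : Bool → LOCC Ω A B C} {τ : A × B × C → A × B × C} {s : Bool}
    (hτ : ∀ x, ψ (τ x) = sgn s * ψ x) (h : Identifies (P s) i ψ) (t : Bool) :
    Identifies (P t) i (fun x => 1 / 2 * (ψ x + sgn t * ψ (τ x))) := by
  by_cases ht : t = s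
  · subst ht
    convert h using 1
    ext x
    rw [hτ, ← mul_assoc, sgn_mul_self]; ring
  · convert identifies_zero (P t) i using 1
    ext x
    rw [hτ]
    cases t <;> cases s <;> simp_all [sgn]

lemma identifies_alice_sign [DecidableEq A] {σ : A → A} (hσ : Function.Involutive σ)
    {next : Bool → LOCC Ω A B C} {s : Bool} (hτ : ∀ x, ψ (σ x.1, x.2) = sgn s * ψ x)
    (h : Identifies (next s) i ψ) :
    Identifies (LOCC.alice Bool A (signMeas σ) (isMeasurement_signMeas hσ) next) i ψ :=
  identifies_alice fun k => by
    rw [vecA_signMeas]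
    exact identifies_sign (P := next) (τ := fun x => (σ x.1, x.2)) hτ h k

lemma identifies_bob_sign [DecidableEq B] {σ : B → B} (hσ : Function.Involutive σ)
    {next : Bool → LOCC Ω A B C} {s : Bool} (hτ : ∀ x, ψ (x.1, σ x.2.1, x.2.2) = sgn s * ψ x)
    (h : Identifies (next s) i ψ) :
    Identifies (LOCC.bob Bool B (signMeas σ) (isMeasurement_signMeas hσ) next) i ψ :=
  identifies_bob fun k => by
    rw [vecB_signMeas]
    exact identifies_sign (P := next) (τ := fun x => (x.1, σ x.2.1, x.2.2)) hτ h k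

lemma identifies_charlie_sign [DecidableEq C] {σ : C → C} (hσ : Function.Involutive σ)
    {next : Bool → LOCC Ω A B C} {s : Bool} (hτ : ∀ x, ψ (x.1, x.2.1, σ x.2.2) = sgn s * ψ x)
    (h : Identifies (next s) i ψ) :
    Identifies (LOCC.charlie Bool C (signMeas σ) (isMeasurement_signMeas hσ) next) i ψ :=
  identifies_charlie fun k => by
    rw [vecC_signMeas]
    exact identifies_sign (P := next) (τ := fun x => (x.1, x.2.1, σ x.2.2)) hτ h k

lemma sgn_beq (s t : Bool) : sgn (s == t) = sgn s * sgn t := by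
  cases s <;> cases t <;> simp [sgn]

/-- If `ψ` is an eigenvector of the product of three local involutions, the parties find the
eigenvalue by measuring their own involutions. -/
lemma identifies_three_signs [DecidableEq A] [DecidableEq B] [DecidableEq C] {α : A → A}
    {β : B → B} {γ : C → C} (hα : Function.Involutive α)
    (hβ : Function.Involutive β) (hγ : Function.Involutive γ) {out : Bool → Ω} {s : Bool}
    (h : ∀ x, ψ (α x.1, β x.2.1, γ x.2.2) = sgn s * ψ x) :
    Identifies (LOCC.bob Bool B (signMeas β) (isMeasurement_signMeas hβ) fun t =>
      LOCC.charlie Bool C (signMeas γ) (isMeasurement_signMeas hγ) fun r =>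
      LOCC.alice Bool A (signMeas α) (isMeasurement_signMeas hα) fun m =>
      LOCC.announce (out ((m == t) == r))) (out s) ψ := by
  refine identifies_bob fun t => identifies_charlie fun r => ?_
  have e : out s = out ((((s == t) == r) == t) == r) := by
    cases s <;> cases t <;> cases r <;> rfl
  -- Bob's and Charlie's outcomes `t`, `r` are random, but they fix Alice's eigenvalue, because the
  -- product of the three signs is `s`; `==` is multiplication of signs.
  refine identifies_alice_sign hα (s := ((s == t) == r)) ?_ ?_
  · rintro ⟨a, b, c⟩
    have hαβγ : ∀ a b c, ψ (α a, β b, γ c) = sgn s * ψ (a, b, c) := fun a b c => h (a, b, c)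
    have h1 := hαβγ a b c
    have h2 := hαβγ a (β b) c
    have h3 := hαβγ a b (γ c)
    have h4 := hαβγ a (β b) (γ c)
    rw [hβ] at h2 h4
    rw [hγ] at h3 h4
    simp only [vecC_signMeas, vecB_signMeas, sgn_beq, h1, h2, h3, h4]
    cases s <;> cases t <;> cases r <;> simp [sgn] <;> ring
  · rw [e]; exact identifies_announce _ _

end

/-! ### The GHZ protocol -/

/-- The parity that Alice measures first: it tells whether her register is in `|p⟩` relative to her
qubit of the GHZ state. -/
def parityA (x : Fin 4 × Fin 2) : Fin 2 := if x.1 = 0 then x.2 else x.2 + 1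

/-- Bob's (and Charlie's) partition of the basis, given Alice's parity `f`: the qubit differs
from `f` exactly if Alice's register is not in `|p⟩`. -/
def partBC (f : Fin 2) (x : Fin 3 × Fin 2) : Fin 3 :=
  if x.2 ≠ f ∧ x.1 = 0 then 0 else if x.2 = f ∧ x.1 ≠ 2 then 1 else 2

/-- Alice's second partition of the basis. -/
def partA (x : Fin 4 × Fin 2) : Fin 3 := if x.1 = 2 then 0 else if x.1 = 3 then 1 else 2

/-- The pair of states that is compatible with a basis state of the registers. -/
def tile (a : Fin 4) (b c : Fin 3) : Fin 7 :=
  if a ≠ 0 ∧ b = 0 then 2 else if a = 0 ∧ b ≠ 2 then 3 else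
  if a ≠ 0 ∧ c = 0 then 5 else if a = 0 ∧ c ≠ 2 then 6 else
  if a = 2 then 1 else if a = 3 then 4 else 0

/-- Exchange of two basis states of the register, leaving the qubit alone. -/
def swapReg {n : ℕ} (i j : Fin n) (x : Fin n × Fin 2) : Fin n × Fin 2 := (Equiv.swap i j x.1, x.2)

/-- The bit flip of the qubit. -/
def flipBit {n : ℕ} (x : Fin n × Fin 2) : Fin n × Fin 2 := (x.1, x.2 + 1)

/-- Exchange of two basis states of the register together with a bit flip of the qubit. -/
def swapFlip {n : ℕ} (i j : Fin n) (x : Fin n × Fin 2) : Fin n × Fin 2 :=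
  (Equiv.swap i j x.1, x.2 + 1)

lemma add_one_add_one (a : Fin 2) : a + 1 + 1 = a := by revert a; decide

lemma swapReg_involutive {n : ℕ} (i j : Fin n) : Function.Involutive (swapReg i j) :=
  fun x => by simp [swapReg]

lemma flipBit_involutive {n : ℕ} : Function.Involutive (flipBit (n := n)) :=
  fun x => by simp [flipBit, add_one_add_one]

lemma swapFlip_involutive {n : ℕ} (i j : Fin n) : Function.Involutive (swapFlip i j) :=
  fun x => by simp [swapFlip, add_one_add_one]

/-- Alice's, Bob's and Charlie's systems: a register and a qubit of the GHZ state. -/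
abbrev GhzProtocol : Type 1 := LOCC Label (Fin 4 × Fin 2) (Fin 3 × Fin 2) (Fin 3 × Fin 2)

/-- Alice finds the sign of the pair `n` by exchanging `i` and `j`. -/
def signA (n : Fin 7) (i j : Fin 4) : GhzProtocol :=
  LOCC.alice Bool _ (signMeas (swapReg i j)) (isMeasurement_signMeas (swapReg_involutive i j))
    fun s => LOCC.announce (n, s)

/-- Bob finds the sign of the pair `n` by exchanging `i` and `j`. -/
def signB (n : Fin 7) (i j : Fin 3) : GhzProtocol :=
  LOCC.bob Bool _ (signMeas (swapReg i j)) (isMeasurement_signMeas (swapReg_involutive i j))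
    fun s => LOCC.announce (n, s)

/-- Charlie finds the sign of the pair `n` by exchanging `i` and `j`. -/
def signC (n : Fin 7) (i j : Fin 3) : GhzProtocol :=
  LOCC.charlie Bool _ (signMeas (swapReg i j)) (isMeasurement_signMeas (swapReg_involutive i j))
    fun s => LOCC.announce (n, s)

/-- All parties together find the sign of the first pair. -/
def signABC : GhzProtocol :=
  LOCC.bob Bool _ (signMeas flipBit) (isMeasurement_signMeas flipBit_involutive) fun t =>
  LOCC.charlie Bool _ (signMeas flipBit) (isMeasurement_signMeas flipBit_involutive) fun r =>
  LOCC.alice Bool _ (signMeas (swapFlip 0 1)) (isMeasurement_signMeas (swapFlip_involutive 0 1))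
    fun m => LOCC.announce (0, ((m == t) == r))

/-- The last part of the protocol, when Alice, Bob or Charlie have to tell apart the pairs
`0`, `1` and `4`. -/
def lastPart : GhzProtocol :=
  LOCC.alice (Fin 3) _ (valueMeas partA) (isMeasurement_valueMeas _)
    ![signB 1 1 2, signC 4 1 2, signABC]

/-- The protocol that identifies the states of `𝔾₃` with the help of a GHZ state. -/
def ghzProtocol : GhzProtocol :=
  LOCC.alice (Fin 2) _ (valueMeas parityA) (isMeasurement_valueMeas _) fun f =>
  LOCC.bob (Fin 3) _ (valueMeas (partBC f)) (isMeasurement_valueMeas _)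
    ![signA 2 1 2, signB 3 0 1,
      LOCC.charlie (Fin 3) _ (valueMeas (partBC f)) (isMeasurement_valueMeas _)
        ![signA 5 1 3, signC 6 0 1, lastPart]]

lemma ket_ne_zero {A : Type} [DecidableEq A] {i x : A} (h : ket i x ≠ 0) : x = i := by
  by_contra hx
  exact h (by simp [ket, hx])

lemma pm_ne_zero {A : Type} [DecidableEq A] {i j x : A} {s : Bool} (h : pm i j s x ≠ 0) :
    x = i ∨ x = j := by
  by_contra! hx
  exact h (by simp [pm, ket, hx])

lemma pm_swap {A : Type} [DecidableEq A] (i j : A) (s : Bool) (x : A) :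
    pm i j s (Equiv.swap i j x) = sgn s * pm i j s x := by
  have h1 : (Equiv.swap i j x = i) ↔ x = j := by
    rw [Equiv.swap_apply_eq_iff, Equiv.swap_apply_left]
  have h2 : (Equiv.swap i j x = j) ↔ x = i := by
    rw [Equiv.swap_apply_eq_iff, Equiv.swap_apply_right]
  have := sgn_mul_self s
  simp only [pm, ket, Pi.smul_apply, Pi.add_apply, Pi.single_apply, smul_eq_mul, h1, h2]
  linear_combination (-(((Real.sqrt 2 : ℝ) : ℂ)⁻¹ * if x = j then 1 else 0)) * this

lemma tile_of_zeta_ne_zero {j : Fin 7} {s : Bool} {a : Fin 4} {b c : Fin 3}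
    (h : zeta (j, s) (a, b, c) ≠ 0) : tile a b c = j := by
  fin_cases j <;> simp only [zeta, prod3, mul_ne_zero_iff] at h <;> obtain ⟨⟨h1, h2⟩, h3⟩ := h
  · obtain rfl := ket_ne_zero h2
    obtain rfl := ket_ne_zero h3
    rcases pm_ne_zero h1 with rfl | rfl <;> rfl
  · obtain rfl := ket_ne_zero h1
    obtain rfl := ket_ne_zero h3
    rcases pm_ne_zero h2 with rfl | rfl <;> rfl
  · obtain rfl := ket_ne_zero h2
    obtain rfl := ket_ne_zero h3
    rcases pm_ne_zero h1 with rfl | rfl <;> rfl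
  · obtain rfl := ket_ne_zero h1
    obtain rfl := ket_ne_zero h3
    rcases pm_ne_zero h2 with rfl | rfl <;> rfl
  · obtain rfl := ket_ne_zero h1
    obtain rfl := ket_ne_zero h2
    rcases pm_ne_zero h3 with rfl | rfl <;> rfl
  · obtain rfl := ket_ne_zero h2
    obtain rfl := ket_ne_zero h3
    rcases pm_ne_zero h1 with rfl | rfl <;> rfl
  · obtain rfl := ket_ne_zero h1
    obtain rfl := ket_ne_zero h2
    rcases pm_ne_zero h3 with rfl | rfl <;> rfl

lemma ghz_ne_zero {a b c : Fin 2} (h : ghz (a, b, c) ≠ 0) : b = a ∧ c = a := by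
  revert h
  fin_cases a <;> fin_cases b <;> fin_cases c <;> simp [ghz, ket]

lemma ghz_flip (a b c : Fin 2) : ghz (a + 1, b + 1, c + 1) = ghz (a, b, c) := by
  fin_cases a <;> fin_cases b <;> fin_cases c <;> simp [ghz, ket]

/-- The state after Alice's first measurement, with outcome `f`. -/
def afterParity (i : Label) (f : Fin 2) :
    (Fin 4 × Fin 2) × (Fin 3 × Fin 2) × (Fin 3 × Fin 2) → ℂ :=
  fun x => if parityA x.1 = f then attach (zeta i) ghz x else 0

lemma afterParity_support {j : Fin 7} {s : Bool} {f : Fin 2} {a : Fin 4} {b c : Fin 3}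
    {u v w : Fin 2} (h : afterParity (j, s) f ((a, u), (b, v), (c, w)) ≠ 0) :
    parityA (a, u) = f ∧ v = u ∧ w = u ∧ tile a b c = j := by
  simp only [afterParity, attach, ite_ne_right_iff, mul_ne_zero_iff] at h
  exact ⟨h.1, (ghz_ne_zero h.2.2).1, (ghz_ne_zero h.2.2).2, tile_of_zeta_ne_zero h.2.1⟩

/-- Bob's outcome on the pair `j`. -/
def outB (j : Fin 7) : Fin 3 := ![2, 2, 0, 1, 2, 2, 2] j

/-- Charlie's outcome on the pair `j`. -/
def outC (j : Fin 7) : Fin 3 := ![2, 2, 2, 2, 2, 0, 1] j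

/-- The outcome of Alice's second partition on the pair `j`. -/
def outA (j : Fin 7) : Fin 3 := ![2, 0, 2, 2, 1, 2, 2] j

/-- On the support all qubits equal `u`, so comparing Bob's qubit with the parity reveals whether
`a` is |p⟩. `tile` is total and branches in the order of the protocol, so no support condition on
the registers is needed. -/
lemma partBC_eq_outB : ∀ a u b c,
    partBC (parityA (a, u)) (b, u) = outB (tile a b c) := by decide

lemma partBC_eq_outC : ∀ a u b c, outB (tile a b c) = 2 →
    partBC (parityA (a, u)) (c, u) = outC (tile a b c) := by decide

lemma partA_eq_outA : ∀ a u b c, outB (tile a b c) = 2 → outC (tile a b c) = 2 →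
    partA (a, u) = outA (tile a b c) := by decide

lemma partBC_of_support {j : Fin 7} {s : Bool} {f : Fin 2} {x}
    (h : afterParity (j, s) f x ≠ 0) : partBC f x.2.1 = outB j := by
  obtain ⟨⟨a, u⟩, ⟨b, v⟩, ⟨c, w⟩⟩ := x
  obtain ⟨rfl, rfl, rfl, rfl⟩ := afterParity_support h
  exact partBC_eq_outB _ _ _ _

lemma partBC_of_support' {j : Fin 7} (hj : outB j = 2) {s : Bool} {f : Fin 2} {x}
    (h : afterParity (j, s) f x ≠ 0) : partBC f x.2.2 = outC j := by
  obtain ⟨⟨a, u⟩, ⟨b, v⟩, ⟨c, w⟩⟩ := x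
  obtain ⟨rfl, rfl, rfl, rfl⟩ := afterParity_support h
  exact partBC_eq_outC _ _ _ _ hj

lemma partA_of_support {j : Fin 7} (hj : outB j = 2) (hj' : outC j = 2) {s : Bool} {f : Fin 2} {x}
    (h : afterParity (j, s) f x ≠ 0) : partA x.1 = outA j := by
  obtain ⟨⟨a, u⟩, ⟨b, v⟩, ⟨c, w⟩⟩ := x
  obtain ⟨rfl, rfl, rfl, rfl⟩ := afterParity_support h
  exact partA_eq_outA _ _ _ _ hj hj'

/-- An exchange that avoids |p⟩ preserves Alice's parity, so the eigenvalue survives her first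
measurement. -/
lemma identifies_signA {n : Fin 7} {i j : Fin 4} (hi : i ≠ 0) (hj : j ≠ 0) {s : Bool} (f : Fin 2)
    (h : ∀ a b c, zeta (n, s) (Equiv.swap i j a, b, c) = sgn s * zeta (n, s) (a, b, c)) :
    Identifies (signA n i j) (n, s) (afterParity (n, s) f) := by
  refine identifies_alice_sign (swapReg_involutive i j) (s := s) (fun x => ?_)
    (identifies_announce _ _)
  have h0 : Equiv.swap i j x.1.1 = 0 ↔ x.1.1 = 0 := by
    rw [Equiv.swap_apply_eq_iff, Equiv.swap_apply_of_ne_of_ne hi.symm hj.symm]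
  have h1 : parityA (swapReg i j x.1) = parityA x.1 := by simp only [parityA, swapReg, h0]
  simp only [afterParity, h1]
  simp [attach, swapReg, h, mul_assoc]

lemma identifies_signB {n : Fin 7} {i j : Fin 3} {s : Bool} (f : Fin 2)
    (h : ∀ a b c, zeta (n, s) (a, Equiv.swap i j b, c) = sgn s * zeta (n, s) (a, b, c)) :
    Identifies (signB n i j) (n, s) (afterParity (n, s) f) := by
  refine identifies_bob_sign (swapReg_involutive i j) (s := s) (fun x => ?_)
    (identifies_announce _ _)
  simp [afterParity, attach, swapReg, h, mul_assoc]

lemma identifies_signC {n : Fin 7} {i j : Fin 3} {s : Bool} (f : Fin 2)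
    (h : ∀ a b c, zeta (n, s) (a, b, Equiv.swap i j c) = sgn s * zeta (n, s) (a, b, c)) :
    Identifies (signC n i j) (n, s) (afterParity (n, s) f) := by
  refine identifies_charlie_sign (swapReg_involutive i j) (s := s) (fun x => ?_)
    (identifies_announce _ _)
  simp [afterParity, attach, swapReg, h, mul_assoc]

lemma parityA_swapFlip {a : Fin 4} (ha : a = 0 ∨ a = 1) (u : Fin 2) :
    parityA (swapFlip 0 1 (a, u)) = parityA (a, u) := by
  rcases ha with rfl | rfl <;> revert u <;> decide

/-- Exchanging |p⟩ and |q⟩ alone would change Alice's parity; the simultaneous bit flip restores it,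
and flips by all three parties leave the GHZ state invariant. -/
lemma identifies_signABC (s : Bool) (f : Fin 2) :
    Identifies signABC (0, s) (afterParity (0, s) f) := by
  refine identifies_three_signs (out := fun s => ((0 : Fin 7), s)) (swapFlip_involutive 0 1)
    flipBit_involutive flipBit_involutive ?_
  rintro ⟨⟨a, u⟩, ⟨b, v⟩, ⟨c, w⟩⟩
  have hz : attach (zeta (0, s)) ghz (swapFlip 0 1 (a, u), flipBit (b, v), flipBit (c, w)) =
      sgn s * attach (zeta (0, s)) ghz ((a, u), (b, v), (c, w)) := by
    simp [attach, swapFlip, flipBit, ghz_flip, zeta, prod3, pm_swap, mul_assoc]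
  simp only [afterParity, hz]
  by_cases ha : pm 0 1 s a = 0
  · simp [attach, zeta, prod3, ha]
  · rw [parityA_swapFlip (pm_ne_zero ha)]
    simp

lemma identifies_ghzProtocol (i : Label) : Identifies ghzProtocol i (attach (zeta i) ghz) := by
  obtain ⟨j, s⟩ := i
  refine identifies_alice fun f => ?_
  rw [vecA_valueMeas]
  change Identifies _ _ (afterParity (j, s) f)
  refine identifies_bob_value (fun x => partBC_of_support) ?_
  by_cases hB : outB j = 2
  · rw [hB]
    refine identifies_charlie_value (fun x => partBC_of_support' hB) ?_
    by_cases hC : outC j = 2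
    · rw [hC]
      refine identifies_alice_value (fun x => partA_of_support hB hC) ?_
      fin_cases j <;> simp [outB, outC] at hB hC
      · exact identifies_signABC s f
      · exact identifies_signB f fun a b c => by simp [zeta, prod3, pm_swap]; ring
      · exact identifies_signC f fun a b c => by simp [zeta, prod3, pm_swap]; ring
    · fin_cases j <;> simp [outB, outC] at hB hC
      · exact identifies_signA (by decide) (by decide) f fun a b c => by
          simp [zeta, prod3, pm_swap]; ring
      · exact identifies_signC f fun a b c => by simp [zeta, prod3, pm_swap]; ring
  · fin_cases j <;> simp [outB] at hB
    · exact identifies_signA (by decide) (by decide) f fun a b c => by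
        simp [zeta, prod3, pm_swap]; ring
    · exact identifies_signB f fun a b c => by simp [zeta, prod3, pm_swap]; ring

lemma nsq_ghz : nsq ghz = 1 := by
  have h : ∀ x, Complex.normSq (ghz x) =
      1 / 2 * ((if x = (0, 0, 0) then 1 else 0) + if x = (1, 1, 1) then 1 else 0) := by
    rintro ⟨a, b, c⟩
    simp only [ghz, ket, Pi.smul_apply, Pi.add_apply, smul_eq_mul, Complex.normSq_mul,
      normSq_inv_sqrt_two, Pi.single_apply]
    fin_cases a <;> fin_cases b <;> fin_cases c <;> simp
  simp only [nsq, h, ← Finset.mul_sum, Finset.sum_add_distrib]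
  simp
  norm_num

lemma success_ghz (p : Label → ℝ) (P : GhzProtocol) :
    success p (proj ghz) P = ∑ i, p i * P.vprob i (attach (zeta i) ghz) := by
  simp only [success, withResource_proj, LOCC.vprob]

/-- With a GHZ state, the states of `𝔾₃` are identified perfectly. -/
lemma one_le_payoff_ghz {p : Label → ℝ} (hp : ∀ i, 0 < p i) (hp1 : ∑ i, p i = 1) :
    1 ≤ payoff p (proj ghz) := by
  have hn : ∀ i, nsq (attach (zeta i) ghz) = 1 := fun i => by
    rw [nsq_attach, nsq_zeta, nsq_ghz, one_mul]
  -- A real supremum dominates its members only if the family is bounded above.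
  have hb : BddAbove (Set.range fun P : GhzProtocol => success p (proj ghz) P) := by
    refine ⟨1, ?_⟩
    rintro _ ⟨P, rfl⟩
    simp only [success_ghz]
    rw [← hp1]
    refine Finset.sum_le_sum fun i _ => mul_le_of_le_one_right (hp i).le ?_
    rw [← hn i]
    exact vprob_le _ _ _
  refine le_trans (le_of_eq ?_) (le_ciSup hb ghzProtocol)
  rw [success_ghz, ← hp1]
  refine Finset.sum_congr rfl fun i _ => ?_
  rw [identifies_ghzProtocol i, hn, mul_one]

end LSD

end

theorem corollary1 (p : LSD.Label → ℝ) (hp : ∀ i, 0 < p i) (hp1 : ∑ i, p i = 1)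
    (d₁ d₂ : ℕ) (ρ : Matrix (Fin d₁ × Fin d₂) (Fin d₁ × Fin d₂) ℂ) (hρ : LSD.IsDensity ρ) :
    LSD.StrictlyBetter p (LSD.proj LSD.ghz) (LSD.sharedAB ρ) ∧
    LSD.StrictlyBetter p (LSD.proj LSD.ghz) (LSD.sharedBC ρ) ∧
    LSD.StrictlyBetter p (LSD.proj LSD.ghz) (LSD.sharedAC ρ) := by
  have h := LSD.one_le_payoff_ghz hp hp1
  exact ⟨(LSD.payoff_sharedAB_lt hp hp1 hρ).trans_le h,
    (LSD.payoff_sharedBC_lt hp hp1 hρ).trans_le h, (LSD.payoff_sharedAC_lt hp hp1 hρ).trans_le h⟩
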